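/- Let $\Omega=\{1,\dots,N\}$. A conditional sampling oracle for a distribution $\mu$ over $\Omega$ gets a set $A\subseteq\Omega$ and, if $\mu(A)>0$, returns a fresh independent sample of $\mu$ conditioned on $A$; on sets with $\mu(A)=0$ the law of its answer, a probability distribution over $\Omega$ that may depend on $A$, is arbitrary. Let $d_{\mathrm{TV}}(\mu,\tau)=\frac12\sum_{x\in\Omega}|\mu(x)-\tau(x)|$, and write $\log^+t=\max\{0,\log t\}$ for $t>0$, and $\log^+0=0$. **Theorem.** There are absolute constants $C$ and $k\in\mathbb N$ such that for every $N\ge 1$ and every $\varepsilon>0$ there is an adaptive randomized algorithm (depending only on $N$ and $\varepsilon$), with access to conditional sampling oracles of two unknown distributions $\mu$ and $\tau$ over $\Omega$, that in every run makes at most $$C\left(\frac{\log^+\log N}{\varepsilon}+\frac1{\varepsilon^5}\right)\left(1+\log^+\frac1\varepsilon\right)^k$$ oracle calls in total, and such that for all distributions $\mu,\tau$ over $\Omega$ and all such oracles: if $\mu=\tau$, then it accepts with probability at least $2/3$; if $d_{\mathrm{TV}}(\mu,\tau)>\varepsilon$, then it rejects with probability at least $2/3$. -/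

import Mathlib

open scoped ENNReal

namespace CondSampling

/-- An adaptive randomized algorithm that has conditional-sampling access to a family of
distributions over `Ω`, indexed by `ι`, and that outputs an element of `β`.

* `output b`: stop and output `b`.
* `coin p next`: draw `a` from the (explicitly given) distribution `p`, using internal randomness
  only, and continue with `next a`.
* `query i A next`: ask the conditional sampling oracle of the `i`-th distribution for a sample
  conditioned on the set `A`, and continue with `next x`, where `x` is the answer. -/
inductive CondAlg (ι Ω β : Type) : Type 1 where
  | output (b : β) : CondAlg ι Ω β
  | coin {α : Type} (p : PMF α) (next : α → CondAlg ι Ω β) : CondAlg ι Ω β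
  | query (i : ι) (A : Set Ω) (next : Ω → CondAlg ι Ω β) : CondAlg ι Ω β

/-- The largest number of oracle calls (conditional samples, from all the distributions together)
on any run: the maximum over all coin outcomes and all oracle answers. -/
noncomputable def CondAlg.maxQueries {ι Ω β : Type} : CondAlg ι Ω β → ℕ∞
  | .output _ => 0
  | .coin _ next => ⨆ a, (next a).maxQueries
  | .query _ _ next => 1 + ⨆ x, (next x).maxQueries

/-- The distribution of the output, when a query of the set `A` to the `i`-th oracle is answered
by a fresh sample from `O i A`, independent of everything that happened before. -/
noncomputable def CondAlg.run {ι Ω β : Type} (O : ι → Set Ω → PMF Ω) :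
    CondAlg ι Ω β → PMF β
  | .output b => PMF.pure b
  | .coin p next => p.bind fun a => (next a).run O
  | .query i A next => (O i A).bind fun x => (next x).run O

/-- `O` is a conditional sampling oracle for `μ`: if `μ(A) > 0` then its answer to `A` is
distributed like `μ` conditioned on `A`. Its answers to sets of probability zero are not
restricted, so that a guarantee for all such `O` holds for every convention about these sets. -/
def IsCondOracle {Ω : Type} (μ : PMF Ω) (O : Set Ω → PMF Ω) : Prop :=
  ∀ (A : Set Ω) (h : ∃ a ∈ A, a ∈ μ.support), O A = μ.filter A h

/-- The total variation distance of two distributions over a finite set. -/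
noncomputable def dTV {Ω : Type} [Fintype Ω] (μ τ : PMF Ω) : ℝ :=
  (1 / 2) * ∑ x, |(μ x).toReal - (τ x).toReal|

end CondSampling

/-!
Equivalence testing with conditional samples: why the tester works.

Let `a`, `b` be the two probability mass functions, and order the elements by `a + b`. If `a` and
`b` are far apart in total variation, then at many elements `x` the ratio of `a x` and `b x`
deviates from the ratio of the masses that `a` and `b` give to the elements before `x`. An
induction along the order makes this quantitative, without any logarithmic loss
(`sum_abs_sub_le`), and a dyadic decomposition provides a level `δ` of deviation at which such
witnesses `x` are sampled from one of the two distributions with a probability `γ` of order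
`ε / δ` up to logarithms (`exists_level`). The same lemmas show that one may assume that the
elements up to `x` have mass at least `γ`, to which both distributions contribute.

Around a witness `x`, take a random set `A` whose density is proportional to `a x + b x`. With
constant probability it contains none of the at most `2 / (a x + b x)` heavier elements, and on
the lighter ones the second moment method shows that with probability of order `δ² γ` the
probabilities of `x` conditioned on `A ∪ {x}` under the two distributions differ by at least
`δ γ / 32` (`binomExp_distinguishes`). About `1 / (δ γ)²` conditional samples detect
this (`acc_compareLoop_le_half`).

The density is found up to a factor of order `1 / γ`, which is guessed, by a binary search over
the powers of two: a sample conditioned on `A ∪ {x}` is most likely `x` if `A` is too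
sparse (`hitProb_ge`), and most likely not `x` if `A` is too dense (`hitProb_le`). The search uses
multiplicative weights and stops at a random time. It makes `O(log J)` noisy tests for `J` levels,
and it succeeds with constant probability (`acc_randomSearch_le`), although nothing is known about
the tests at levels in between.

If the distributions are equal then every comparison is between equal probabilities, wherever the
search ends, so that only the Chernoff bound for the comparisons matters (`le_acc_compareLoop`).
An oracle's answers to null sets do no harm: `x` has positive mass under the distribution it is
sampled from, and a distinguishing set has positive mass under both. Of the order of `1 / γ`
trials, each with one search and about `1 / (δ² γ)` probes, detect the distance, so that up to
logarithms in `1 / ε` the number of queries is `log log N / ε + 1 / (δ γ) ^ 4`, and `δ γ` is of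
order `ε`.
-/

namespace CondSampling

/-! ### Locating the discrepancy of two mass functions -/

section Structure

variable {α : Type*} [LinearOrder α]

/-- `Precedes w y x`: `y` comes before `x` in the order by increasing weight `w`, in which ties
are broken by the order of the type. -/
def Precedes (w : α → ℝ) (y x : α) : Prop := w y < w x ∨ (w y = w x ∧ y < x)

lemma Precedes.le {w : α → ℝ} {y x : α} (h : Precedes w y x) : w y ≤ w x := by
  rcases h with h | h
  · exact h.le
  · exact h.1.le

lemma not_precedes_self (w : α → ℝ) (x : α) : ¬ Precedes w x x := by
  simp [Precedes]

lemma Precedes.asymm {w : α → ℝ} {y x : α} (h : Precedes w y x) : ¬ Precedes w x y := by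
  rintro h'
  rcases h with h | h <;> rcases h' with h' | h'
  · exact lt_asymm h h'
  · exact h.ne' h'.1
  · exact h'.ne' h.1
  · exact lt_asymm h.2 h'.2

lemma precedes_or_eq_or_precedes (w : α → ℝ) (y x : α) :
    Precedes w y x ∨ y = x ∨ Precedes w x y := by
  rcases lt_trichotomy (w y) (w x) with h | h | h
  · exact Or.inl (Or.inl h)
  · rcases lt_trichotomy y x with h' | h' | h'
    · exact Or.inl (Or.inr ⟨h, h'⟩)
    · exact Or.inr (Or.inl h')
    · exact Or.inr (Or.inr (Or.inr ⟨h.symm, h'⟩))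
  · exact Or.inr (Or.inr (Or.inl h))

lemma exists_last {s : Finset α} (w : α → ℝ) (hs : s.Nonempty) :
    ∃ x ∈ s, ∀ y ∈ s, y = x ∨ Precedes w y x := by
  obtain ⟨x, hx, hmax⟩ := s.exists_max_image (fun x => toLex (w x, x)) hs
  refine ⟨x, hx, fun y hy => ?_⟩
  have h := hmax y hy
  rw [Prod.Lex.le_iff] at h
  simp only [ofLex_toLex] at h
  rcases h with h | ⟨h, h'⟩
  · exact Or.inr (Or.inl h)
  · rcases h'.lt_or_eq with h' | h'
    · exact Or.inr (Or.inr ⟨h, h'⟩)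
    · exact Or.inl h'

open Classical in
/-- The elements of `s` that come before `x`. -/
noncomputable def lighter (w : α → ℝ) (s : Finset α) (x : α) : Finset α :=
  s.filter fun y => Precedes w y x

open Classical in
/-- The elements of `s` that come after `x`. -/
noncomputable def heavier (w : α → ℝ) (s : Finset α) (x : α) : Finset α :=
  s.filter fun y => Precedes w x y

lemma mem_lighter {w : α → ℝ} {s : Finset α} {x y : α} :
    y ∈ lighter w s x ↔ y ∈ s ∧ Precedes w y x := by
  simp [lighter]

lemma mem_heavier {w : α → ℝ} {s : Finset α} {x y : α} :
    y ∈ heavier w s x ↔ y ∈ s ∧ Precedes w x y := by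
  simp [heavier]

/-- The joint mass `a + b` of `x` together with everything in `s` that comes before it. -/
noncomputable def lowMass (a b : α → ℝ) (s : Finset α) (x : α) : ℝ :=
  ∑ y ∈ lighter (a + b) s x, (a y + b y) + (a x + b x)

/-- How much the ratio of `a` and `b` at `x` deviates from their ratio on the elements before
`x`. -/
noncomputable def discrepancy (a b : α → ℝ) (s : Finset α) (x : α) : ℝ :=
  |a x * ∑ y ∈ lighter (a + b) s x, b y - b x * ∑ y ∈ lighter (a + b) s x, a y|

/-- `a` and `b` give comparable masses to the set of `x` and the elements before it. -/
def Balanced (a b : α → ℝ) (s : Finset α) (x : α) : Prop :=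
  |(∑ y ∈ lighter (a + b) s x, a y + a x) - (∑ y ∈ lighter (a + b) s x, b y + b x)|
    ≤ lowMass a b s x / 2

/-- The step of the induction in `sum_abs_sub_le`: `M`, `T` are the masses of an initial segment
and `a`, `b` those of the next element. -/
lemma abs_sub_add_abs_sub_le {M T a b : ℝ} (hM : 0 ≤ M) (hT : 0 ≤ T) (ha : 0 ≤ a) (hb : 0 ≤ b) :
    |a - b| + |M - T| ≤
      |(M + a) - (T + b)| + 4 * (|a * T - b * M| / (M + T + (a + b))) := by
  have hden : 0 ≤ M + T + (a + b) := by positivity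
  rcases hden.eq_or_lt with h0 | hpos
  · have : M = 0 := by linarith
    have : T = 0 := by linarith
    have : a = 0 := by linarith
    have : b = 0 := by linarith
    subst_vars
    simp
  · suffices h : (|a - b| + |M - T| - |(M + a) - (T + b)|) * (M + T + (a + b))
        ≤ 4 * |a * T - b * M| by
      have h2 := (le_div_iff₀ hpos).2 h
      rw [mul_div_assoc] at h2
      linarith
    rcases le_total b a with h1 | h1 <;> rcases le_total T M with h2 | h2
    · have : |(M + a) - (T + b)| = (M + a) - (T + b) := abs_of_nonneg (by linarith)
      rw [this, abs_of_nonneg (by linarith : 0 ≤ a - b), abs_of_nonneg (by linarith : 0 ≤ M - T)]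
      have := abs_nonneg (a * T - b * M)
      nlinarith
    · have hD : 0 ≤ a * T - b * M := by nlinarith
      rw [abs_of_nonneg hD, abs_of_nonneg (by linarith : 0 ≤ a - b),
        abs_of_nonpos (by linarith : M - T ≤ 0)]
      rcases le_total (T + b) (M + a) with h3 | h3
      · rw [abs_of_nonneg (by linarith)]
        nlinarith [mul_nonneg (by linarith : 0 ≤ M + T) (sub_nonneg.2 h3)]
      · rw [abs_of_nonpos (by linarith)]
        nlinarith [mul_nonneg (by linarith : 0 ≤ a + b) (sub_nonneg.2 h3)]
    · have hD : a * T - b * M ≤ 0 := by nlinarith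
      rw [abs_of_nonpos hD, abs_of_nonpos (by linarith : a - b ≤ 0),
        abs_of_nonneg (by linarith : 0 ≤ M - T)]
      rcases le_total (T + b) (M + a) with h3 | h3
      · rw [abs_of_nonneg (by linarith)]
        nlinarith [mul_nonneg (by linarith : 0 ≤ a + b) (sub_nonneg.2 h3)]
      · rw [abs_of_nonpos (by linarith)]
        nlinarith [mul_nonneg (by linarith : 0 ≤ M + T) (sub_nonneg.2 h3)]
    · have : |(M + a) - (T + b)| = -((M + a) - (T + b)) := abs_of_nonpos (by linarith)
      rw [this, abs_of_nonpos (by linarith : a - b ≤ 0), abs_of_nonpos (by linarith : M - T ≤ 0)]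
      have := abs_nonneg (a * T - b * M)
      nlinarith

open Classical in
/-- The elements that witness the distance of `a` and `b`: the deviations of the ratio of `a` and
`b` from its average over the lighter elements, at those elements where this average is neither
small nor large, control the `ℓ¹`-distance. -/
lemma sum_abs_sub_le (a b : α → ℝ) (ha : ∀ x, 0 ≤ a x) (hb : ∀ x, 0 ≤ b x) (s : Finset α) :
    ∑ x ∈ s, |a x - b x| ≤ 2 * |∑ x ∈ s, a x - ∑ x ∈ s, b x| +
      8 * ∑ x ∈ s with Balanced a b s x, discrepancy a b s x / lowMass a b s x := by
  induction hn : s.card generalizing s with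
  | zero =>
    rw [Finset.card_eq_zero] at hn
    subst hn
    simp
  | succ n ih =>
    have hne : s.Nonempty := by
      rw [← Finset.card_pos]; omega
    obtain ⟨x, hx, hlast⟩ := exists_last (a + b) hne
    obtain ⟨t, hxt, rfl⟩ : ∃ t, x ∉ t ∧ insert x t = s :=
      ⟨s.erase x, Finset.notMem_erase x s, Finset.insert_erase hx⟩
    have hcard : t.card = n := by
      rw [Finset.card_insert_of_notMem hxt] at hn; omega
    have IH := ih t hcard
    have hprec : ∀ y ∈ t, Precedes (a + b) y x := fun y hy => by
      rcases hlast y (Finset.mem_insert_of_mem hy) with h | h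
      · exact absurd (h ▸ hy) hxt
      · exact h
    have hLx : lighter (a + b) (insert x t) x = t := by
      ext y
      simp only [lighter, Finset.mem_filter, Finset.mem_insert]
      constructor
      · rintro ⟨rfl | h, h'⟩
        · exact absurd h' (not_precedes_self _ _)
        · exact h
      · exact fun h => ⟨Or.inr h, hprec y h⟩
    have hLy : ∀ y ∈ t, lighter (a + b) (insert x t) y = lighter (a + b) t y := fun y hy => by
      ext z
      simp only [lighter, Finset.mem_filter, Finset.mem_insert]
      constructor
      · rintro ⟨rfl | h, h'⟩
        · exact absurd h' (hprec y hy).asymm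
        · exact ⟨h, h'⟩
      · exact fun h => ⟨Or.inr h.1, h.2⟩
    have hsum : ∑ y ∈ t with Balanced a b (insert x t) y,
          discrepancy a b (insert x t) y / lowMass a b (insert x t) y =
        ∑ y ∈ t with Balanced a b t y, discrepancy a b t y / lowMass a b t y := by
      have hf : (t.filter fun y => Balanced a b (insert x t) y) =
          t.filter fun y => Balanced a b t y := by
        refine Finset.filter_congr fun y hy => ?_
        simp only [Balanced, lowMass, hLy y hy]
      rw [hf]
      refine Finset.sum_congr rfl fun y hy => ?_
      have hy' := (Finset.mem_filter.1 hy).1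
      simp only [discrepancy, lowMass, hLy y hy']
    have hnn : 0 ≤ ∑ y ∈ t with Balanced a b t y, discrepancy a b t y / lowMass a b t y := by
      refine Finset.sum_nonneg fun y _ => div_nonneg (abs_nonneg _) ?_
      exact add_nonneg (Finset.sum_nonneg fun z _ => add_nonneg (ha z) (hb z))
        (add_nonneg (ha y) (hb y))
    rw [Finset.filter_insert]
    by_cases hbal : Balanced a b (insert x t) x
    · rw [if_pos hbal, Finset.sum_insert (fun h => hxt (Finset.mem_filter.1 h).1), hsum,
        Finset.sum_insert hxt, Finset.sum_insert hxt, Finset.sum_insert hxt]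
      have step := abs_sub_add_abs_sub_le (M := ∑ y ∈ t, a y) (T := ∑ y ∈ t, b y)
        (Finset.sum_nonneg fun y _ => ha y) (Finset.sum_nonneg fun y _ => hb y) (ha x) (hb x)
      have hd : discrepancy a b (insert x t) x / lowMass a b (insert x t) x =
          |a x * ∑ y ∈ t, b y - b x * ∑ y ∈ t, a y| /
            (∑ y ∈ t, a y + ∑ y ∈ t, b y + (a x + b x)) := by
        simp only [discrepancy, lowMass, hLx, Finset.sum_add_distrib]
      rw [hd, add_comm (a x), add_comm (b x)]
      have := abs_nonneg (a x - b x)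
      linarith
    · -- An unbalanced segment has a difference of masses comparable to its total mass.
      rw [if_neg hbal, hsum, Finset.sum_insert hxt, Finset.sum_insert hxt, Finset.sum_insert hxt]
      simp only [Balanced, lowMass, hLx, not_le, Finset.sum_add_distrib] at hbal
      have h1 : ∑ y ∈ t, |a y - b y| ≤ ∑ y ∈ t, a y + ∑ y ∈ t, b y := by
        rw [← Finset.sum_add_distrib]
        refine Finset.sum_le_sum fun y _ => abs_le.2 ⟨?_, ?_⟩ <;> linarith [ha y, hb y]
      have h2 : |a x - b x| ≤ a x + b x := abs_le.2 ⟨by linarith [ha x, hb x], by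
        linarith [ha x, hb x]⟩
      rw [add_comm (a x), add_comm (b x)]
      linarith

/-- The elements below which there is little mass carry little mass. -/
lemma sum_lowMass_lt_le (a b : α → ℝ) (ha : ∀ x, 0 ≤ a x) (hb : ∀ x, 0 ≤ b x) (s : Finset α)
    {γ : ℝ} (hγ : 0 ≤ γ) :
    ∑ x ∈ s with lowMass a b s x < γ, (a x + b x) ≤ γ := by
  classical
  rcases (s.filter fun x => lowMass a b s x < γ).eq_empty_or_nonempty with h | h
  · rw [h]; simpa using hγ
  · obtain ⟨x, hx, hlast⟩ := exists_last (a + b) h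
    have hx' := Finset.mem_filter.1 hx
    refine le_trans ?_ hx'.2.le
    have hxL : x ∉ lighter (a + b) s x := fun h => not_precedes_self _ _ (Finset.mem_filter.1 h).2
    have : lowMass a b s x = ∑ y ∈ insert x (lighter (a + b) s x), (a y + b y) := by
      rw [Finset.sum_insert hxL, lowMass, add_comm]
    rw [this]
    refine Finset.sum_le_sum_of_subset_of_nonneg (fun y hy => ?_)
      (fun y _ _ => add_nonneg (ha y) (hb y))
    rcases hlast y hy with h | h
    · simp [h]
    · exact Finset.mem_insert_of_mem (Finset.mem_filter.2 ⟨(Finset.mem_filter.1 hy).1, h⟩)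

end Structure

/-! ### Random subsets -/

section RandomSubset

variable {α : Type*}

/-- The expectation of `F A`, where `A` is a random subset of `s` that contains every element
independently with probability `p`. -/
noncomputable def binomExp (p : ℝ) (s : Finset α) (F : Finset α → ℝ) : ℝ :=
  ∑ A ∈ s.powerset, p ^ A.card * (1 - p) ^ (s.card - A.card) * F A

lemma binomExp_empty (p : ℝ) (F : Finset α → ℝ) : binomExp p ∅ F = F ∅ := by
  simp [binomExp]

lemma binomExp_insert [DecidableEq α] (p : ℝ) {s : Finset α} {x : α} (hx : x ∉ s)
    (F : Finset α → ℝ) :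
    binomExp p (insert x s) F =
      (1 - p) * binomExp p s F + p * binomExp p s (fun A => F (insert x A)) := by
  unfold binomExp
  rw [Finset.sum_powerset_insert hx, Finset.mul_sum, Finset.mul_sum]
  congr 1
  · refine Finset.sum_congr rfl fun A hA => ?_
    have hc := Finset.card_le_card (Finset.mem_powerset.1 hA)
    rw [Finset.card_insert_of_notMem hx, Nat.succ_sub hc, pow_succ]
    ring
  · refine Finset.sum_congr rfl fun A hA => ?_
    have hxA : x ∉ A := fun h => hx (Finset.mem_powerset.1 hA h)
    rw [Finset.card_insert_of_notMem hx, Finset.card_insert_of_notMem hxA, Nat.add_sub_add_right,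
      pow_succ]
    ring

lemma binomExp_weight_nonneg {p : ℝ} (h0 : 0 ≤ p) (h1 : p ≤ 1) (s A : Finset α) :
    0 ≤ p ^ A.card * (1 - p) ^ (s.card - A.card) := by
  have : 0 ≤ 1 - p := by linarith
  positivity

lemma binomExp_mono {p : ℝ} (h0 : 0 ≤ p) (h1 : p ≤ 1) (s : Finset α) {F G : Finset α → ℝ}
    (h : ∀ A ⊆ s, F A ≤ G A) : binomExp p s F ≤ binomExp p s G :=
  Finset.sum_le_sum fun A hA => mul_le_mul_of_nonneg_left (h A (Finset.mem_powerset.1 hA))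
    (binomExp_weight_nonneg h0 h1 s A)

lemma binomExp_add (p : ℝ) (s : Finset α) (F G : Finset α → ℝ) :
    binomExp p s (fun A => F A + G A) = binomExp p s F + binomExp p s G := by
  simp only [binomExp, mul_add, Finset.sum_add_distrib]

lemma binomExp_const_mul (p : ℝ) (s : Finset α) (c : ℝ) (F : Finset α → ℝ) :
    binomExp p s (fun A => c * F A) = c * binomExp p s F := by
  simp only [binomExp, Finset.mul_sum]
  exact Finset.sum_congr rfl fun A _ => by ring

lemma binomExp_const [DecidableEq α] (p : ℝ) (s : Finset α) (c : ℝ) :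
    binomExp p s (fun _ => c) = c := by
  induction s using Finset.induction_on with
  | empty => simp [binomExp_empty]
  | insert x s hx ih => rw [binomExp_insert p hx, ih]; ring

lemma binomExp_nonneg [DecidableEq α] {p : ℝ} (h0 : 0 ≤ p) (h1 : p ≤ 1) (s : Finset α)
    {F : Finset α → ℝ} (h : ∀ A ⊆ s, 0 ≤ F A) : 0 ≤ binomExp p s F := by
  rw [← binomExp_const p s 0]
  exact binomExp_mono h0 h1 s h

/-- The mean and the variance of the mass of a random subset. -/
lemma binomExp_sum_sub_sq [DecidableEq α] (p : ℝ) (s : Finset α) (w : α → ℝ) (c : ℝ) :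
    binomExp p s (fun A => (∑ y ∈ A, w y - c) ^ 2) =
      (p * ∑ y ∈ s, w y - c) ^ 2 + p * (1 - p) * ∑ y ∈ s, w y ^ 2 := by
  induction s using Finset.induction_on generalizing c with
  | empty => simp [binomExp_empty]
  | insert x s hx ih =>
    have h : binomExp p s (fun A => (∑ y ∈ insert x A, w y - c) ^ 2) =
        binomExp p s (fun A => (∑ y ∈ A, w y - (c - w x)) ^ 2) := by
      refine Finset.sum_congr rfl fun A hA => ?_
      have hxA : x ∉ A := fun h => hx (Finset.mem_powerset.1 hA h)
      simp only [Finset.sum_insert hxA]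
      ring
    rw [binomExp_insert p hx, h, ih, ih, Finset.sum_insert hx, Finset.sum_insert hx]
    ring

lemma binomExp_sum [DecidableEq α] (p : ℝ) (s : Finset α) (w : α → ℝ) :
    binomExp p s (fun A => ∑ y ∈ A, w y) = p * ∑ y ∈ s, w y := by
  induction s using Finset.induction_on with
  | empty => simp [binomExp_empty]
  | insert x s hx ih =>
    have h : binomExp p s (fun A => ∑ y ∈ insert x A, w y) =
        binomExp p s (fun A => w x + ∑ y ∈ A, w y) := by
      refine Finset.sum_congr rfl fun A hA => ?_
      have hxA : x ∉ A := fun h => hx (Finset.mem_powerset.1 hA h)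
      simp only [Finset.sum_insert hxA]
    rw [binomExp_insert p hx, h, binomExp_add, binomExp_const, ih, Finset.sum_insert hx]
    ring

/-- An antitone function can only decrease when more elements take part. -/
lemma binomExp_union_le [DecidableEq α] {p : ℝ} (h0 : 0 ≤ p) (h1 : p ≤ 1) (s t : Finset α)
    {F : Finset α → ℝ} (hF : ∀ A x, F (insert x A) ≤ F A) :
    binomExp p (s ∪ t) F ≤ binomExp p s F := by
  induction t using Finset.induction_on with
  | empty => simp
  | insert x t _ ih =>
    rw [Finset.union_insert]
    by_cases hx : x ∈ s ∪ t
    · rwa [Finset.insert_eq_of_mem hx]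
    · rw [binomExp_insert p hx]
      have := binomExp_mono h0 h1 (s ∪ t) (F := fun A => F (insert x A)) (G := F)
        (fun A _ => hF A x)
      nlinarith

/-- A lower bound from the event that none of the elements of `t` is chosen. -/
lemma le_binomExp_union [DecidableEq α] {p : ℝ} (h0 : 0 ≤ p) (h1 : p ≤ 1) (s t : Finset α)
    {F : Finset α → ℝ} (hF : ∀ A, 0 ≤ F A) :
    (1 - p) ^ t.card * binomExp p s F ≤ binomExp p (s ∪ t) F := by
  have hp : 0 ≤ 1 - p := by linarith
  induction t using Finset.induction_on with
  | empty => simp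
  | insert x t hxt ih =>
    rw [Finset.union_insert, Finset.card_insert_of_notMem hxt, pow_succ]
    have hE := binomExp_nonneg h0 h1 s (fun A _ => hF A)
    have hle : (1 - p) ^ t.card * (1 - p) * binomExp p s F ≤ (1 - p) * binomExp p (s ∪ t) F := by
      nlinarith
    by_cases hx : x ∈ s ∪ t
    · rw [Finset.insert_eq_of_mem hx]
      have := binomExp_nonneg h0 h1 (s ∪ t) (fun A _ => hF A)
      nlinarith
    · rw [binomExp_insert p hx]
      have := binomExp_nonneg h0 h1 (s ∪ t) (F := fun A => F (insert x A)) (fun A _ => hF _)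
      nlinarith [mul_nonneg h0 this]

end RandomSubset

/-! ### Acceptance probabilities and query counts -/

section Accept

variable {ι Ω : Type}

/-- The probability that an algorithm with Boolean output accepts. -/
noncomputable def CondAlg.acc (O : ι → Set Ω → PMF Ω) (alg : CondAlg ι Ω Bool) : ℝ :=
  (alg.run O true).toReal

lemma CondAlg.acc_nonneg (O : ι → Set Ω → PMF Ω) (alg : CondAlg ι Ω Bool) : 0 ≤ alg.acc O :=
  ENNReal.toReal_nonneg

lemma CondAlg.acc_le_one (O : ι → Set Ω → PMF Ω) (alg : CondAlg ι Ω Bool) : alg.acc O ≤ 1 :=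
  ENNReal.toReal_le_of_le_ofReal zero_le_one (by simpa using PMF.coe_le_one _ _)

lemma CondAlg.run_false_toReal (O : ι → Set Ω → PMF Ω) (alg : CondAlg ι Ω Bool) :
    (alg.run O false).toReal = 1 - alg.acc O := by
  have h := (alg.run O).tsum_coe
  rw [tsum_fintype, Fintype.sum_bool] at h
  have h2 := congrArg ENNReal.toReal h
  rw [ENNReal.toReal_add (PMF.apply_ne_top _ _) (PMF.apply_ne_top _ _)] at h2
  simp only [ENNReal.toReal_one] at h2
  rw [CondAlg.acc]
  linarith

@[simp] lemma CondAlg.acc_output (O : ι → Set Ω → PMF Ω) (b : Bool) :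
    (CondAlg.output b : CondAlg ι Ω Bool).acc O = if b then 1 else 0 := by
  cases b <;> simp [CondAlg.acc, CondAlg.run, PMF.pure_apply]

/-- A distribution over a finite type has total mass one, in real numbers. -/
lemma sum_toReal_eq_one {α : Type*} [Fintype α] (p : PMF α) : ∑ a, (p a).toReal = 1 := by
  have h := p.tsum_coe
  rw [tsum_fintype] at h
  rw [← ENNReal.toReal_sum (fun a _ => PMF.apply_ne_top p a), h, ENNReal.toReal_one]

lemma toReal_bind_apply {α β : Type*} [Fintype α] (p : PMF α) (f : α → PMF β) (b : β) :
    ((p.bind f) b).toReal = ∑ a, (p a).toReal * (f a b).toReal := by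
  rw [PMF.bind_apply, tsum_fintype, ENNReal.toReal_sum
    (fun a _ => ENNReal.mul_ne_top (PMF.apply_ne_top _ _) (PMF.apply_ne_top _ _))]
  simp only [ENNReal.toReal_mul]

lemma CondAlg.acc_coin (O : ι → Set Ω → PMF Ω) {α : Type} [Fintype α] (p : PMF α)
    (next : α → CondAlg ι Ω Bool) :
    (CondAlg.coin p next).acc O = ∑ a, (p a).toReal * (next a).acc O :=
  toReal_bind_apply _ _ _

lemma CondAlg.acc_query [Fintype Ω] (O : ι → Set Ω → PMF Ω) (i : ι) (A : Set Ω)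
    (next : Ω → CondAlg ι Ω Bool) :
    (CondAlg.query i A next).acc O = ∑ x, (O i A x).toReal * (next x).acc O :=
  toReal_bind_apply _ _ _

/-- An average is at least any lower bound that holds on the support. -/
lemma le_sum_toReal_mul {α : Type*} [Fintype α] (p : PMF α) (f : α → ℝ) {c : ℝ}
    (h : ∀ a ∈ p.support, c ≤ f a) : c ≤ ∑ a, (p a).toReal * f a := by
  calc c = ∑ a, (p a).toReal * c := by rw [← Finset.sum_mul, sum_toReal_eq_one, one_mul]
    _ ≤ _ := Finset.sum_le_sum fun a _ => by
      by_cases ha : a ∈ p.support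
      · exact mul_le_mul_of_nonneg_left (h a ha) ENNReal.toReal_nonneg
      · rw [PMF.mem_support_iff, not_not] at ha
        simp [ha]

/-- An event of probability at least `η` on which the value is at most `1 - r` pushes the average
down to `1 - η r`. -/
lemma sum_toReal_mul_le {α : Type*} [Fintype α] (p : PMF α) (f : α → ℝ) {η r : ℝ} (hr : 0 ≤ r)
    (S : Finset α) (hS : η ≤ ∑ a ∈ S, (p a).toReal) (h1 : ∀ a, f a ≤ 1)
    (h : ∀ a ∈ S, f a ≤ 1 - r) : ∑ a, (p a).toReal * f a ≤ 1 - η * r := by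
  classical
  calc ∑ a, (p a).toReal * f a
      ≤ ∑ a, ((p a).toReal - if a ∈ S then (p a).toReal * r else 0) := by
        refine Finset.sum_le_sum fun a _ => ?_
        have := ENNReal.toReal_nonneg (a := p a)
        split_ifs with ha
        · nlinarith [h a ha]
        · nlinarith [h1 a]
    _ = 1 - (∑ a ∈ S, (p a).toReal) * r := by
        rw [Finset.sum_sub_distrib, sum_toReal_eq_one, Finset.sum_ite_mem, Finset.univ_inter,
          Finset.sum_mul]
    _ ≤ _ := by nlinarith

/-- Run `a`, and if it accepts, run `b`; accept if both do. -/
noncomputable def CondAlg.both (b : CondAlg ι Ω Bool) : CondAlg ι Ω Bool → CondAlg ι Ω Bool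
  | .output true => b
  | .output false => .output false
  | .coin p next => .coin p fun a => CondAlg.both b (next a)
  | .query i A next => .query i A fun x => CondAlg.both b (next x)

lemma CondAlg.acc_both (O : ι → Set Ω → PMF Ω) (b a : CondAlg ι Ω Bool) :
    (CondAlg.both b a).acc O = a.acc O * b.acc O := by
  rw [CondAlg.acc, CondAlg.acc, CondAlg.acc, ← ENNReal.toReal_mul]
  congr 1
  induction a with
  | output r => cases r <;> simp [CondAlg.both, CondAlg.run, PMF.pure_apply]
  | coin p next ih =>
    simp only [CondAlg.both, CondAlg.run, PMF.bind_apply, ih]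
    rw [← ENNReal.tsum_mul_right]
    simp only [mul_assoc]
  | query i A next ih =>
    simp only [CondAlg.both, CondAlg.run, PMF.bind_apply, ih]
    rw [← ENNReal.tsum_mul_right]
    simp only [mul_assoc]

lemma CondAlg.maxQueries_both {b a : CondAlg ι Ω Bool} {m n : ℕ} (hb : b.maxQueries ≤ m)
    (ha : a.maxQueries ≤ n) : (CondAlg.both b a).maxQueries ≤ (n + m : ℕ) := by
  suffices h : (CondAlg.both b a).maxQueries ≤ a.maxQueries + b.maxQueries by
    refine h.trans ?_
    push_cast
    exact add_le_add ha hb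
  clear ha hb
  induction a with
  | output r => cases r <;> simp [CondAlg.both, CondAlg.maxQueries]
  | coin p next ih =>
    simp only [CondAlg.both, CondAlg.maxQueries]
    exact iSup_le fun a => (ih a).trans
      (add_le_add_left (le_iSup (fun a => (next a).maxQueries) a) _)
  | query i A next ih =>
    simp only [CondAlg.both, CondAlg.maxQueries, add_assoc]
    refine add_le_add_right (iSup_le fun a => ?_) _
    exact (ih a).trans (add_le_add_left (le_iSup (fun a => (next a).maxQueries) a) _)

lemma CondAlg.maxQueries_coin {β α : Type} (p : PMF α) (next : α → CondAlg ι Ω β) {n : ℕ}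
    (h : ∀ a, (next a).maxQueries ≤ n) : (CondAlg.coin p next).maxQueries ≤ n := by
  simp only [CondAlg.maxQueries]
  exact iSup_le h

lemma CondAlg.maxQueries_query {β : Type} (i : ι) (A : Set Ω) (next : Ω → CondAlg ι Ω β) {n : ℕ}
    (h : ∀ a, (next a).maxQueries ≤ n) : (CondAlg.query i A next).maxQueries ≤ (n + 1 : ℕ) := by
  simp only [CondAlg.maxQueries]
  push_cast
  rw [add_comm]
  exact add_le_add_left (iSup_le h) _

/-- Accept if `n` independent runs of `a` all accept. -/
noncomputable def CondAlg.repeated (a : CondAlg ι Ω Bool) : ℕ → CondAlg ι Ω Bool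
  | 0 => .output true
  | n + 1 => CondAlg.both (CondAlg.repeated a n) a

lemma CondAlg.acc_repeated (O : ι → Set Ω → PMF Ω) (a : CondAlg ι Ω Bool) (n : ℕ) :
    (a.repeated n).acc O = a.acc O ^ n := by
  induction n with
  | zero => simp [CondAlg.repeated]
  | succ n ih => rw [CondAlg.repeated, CondAlg.acc_both, ih, pow_succ']

lemma CondAlg.maxQueries_repeated {a : CondAlg ι Ω Bool} {m : ℕ} (ha : a.maxQueries ≤ m) (n : ℕ) :
    (a.repeated n).maxQueries ≤ (n * m : ℕ) := by
  induction n with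
  | zero => simp [CondAlg.repeated, CondAlg.maxQueries]
  | succ n ih =>
    rw [CondAlg.repeated, Nat.succ_mul, add_comm]
    exact CondAlg.maxQueries_both ih ha

/-- Accept if all of the algorithms `a 0`, …, `a (n - 1)` accept. -/
noncomputable def CondAlg.allOf (a : ℕ → CondAlg ι Ω Bool) : ℕ → CondAlg ι Ω Bool
  | 0 => .output true
  | n + 1 => CondAlg.both (CondAlg.allOf a n) (a n)

lemma CondAlg.acc_allOf (O : ι → Set Ω → PMF Ω) (a : ℕ → CondAlg ι Ω Bool) (n : ℕ) :
    (CondAlg.allOf a n).acc O = ∏ i ∈ Finset.range n, (a i).acc O := by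
  induction n with
  | zero => simp [CondAlg.allOf]
  | succ n ih => rw [CondAlg.allOf, CondAlg.acc_both, ih, Finset.prod_range_succ, mul_comm]

lemma CondAlg.maxQueries_allOf {a : ℕ → CondAlg ι Ω Bool} {q : ℕ → ℕ}
    (ha : ∀ i, (a i).maxQueries ≤ q i) (n : ℕ) :
    (CondAlg.allOf a n).maxQueries ≤ (∑ i ∈ Finset.range n, q i : ℕ) := by
  induction n with
  | zero => simp [CondAlg.allOf, CondAlg.maxQueries]
  | succ n ih =>
    rw [CondAlg.allOf, Finset.sum_range_succ, add_comm]
    exact CondAlg.maxQueries_both ih (ha n)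

end Accept

/-! ### Random subsets as coins -/

section RandSubset

variable {α : Type} [DecidableEq α]

/-- The random subset of `s` that contains every element independently with
probability `2⁻ʲ`. -/
noncomputable def randSubset [Fintype α] (j : ℕ) (s : Finset α) : PMF (Finset α) :=
  PMF.ofFinset (fun A => if A ∈ s.powerset then
      ENNReal.ofReal (((1 / 2 : ℝ) ^ j) ^ A.card * (1 - (1 / 2 : ℝ) ^ j) ^ (s.card - A.card))
      else 0)
    s.powerset
    (by
      have h : ∑ A ∈ s.powerset,
          ((1 / 2 : ℝ) ^ j) ^ A.card * (1 - (1 / 2 : ℝ) ^ j) ^ (s.card - A.card) = 1 := by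
        have := binomExp_const ((1 / 2 : ℝ) ^ j) s 1
        simpa [binomExp] using this
      rw [Finset.sum_congr rfl (fun A hA => if_pos hA), ← ENNReal.ofReal_sum_of_nonneg, h,
        ENNReal.ofReal_one]
      exact fun A _ => binomExp_weight_nonneg (by positivity)
        (pow_le_one₀ (by norm_num) (by norm_num)) s A)
    (fun A hA => if_neg hA)

lemma sum_randSubset_mul [Fintype α] (j : ℕ) (s : Finset α) (F : Finset α → ℝ) :
    ∑ A, (randSubset j s A).toReal * F A = binomExp ((1 / 2 : ℝ) ^ j) s F := by
  rw [binomExp, ← Finset.sum_subset (Finset.subset_univ s.powerset)]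
  · refine Finset.sum_congr rfl fun A hA => ?_
    rw [randSubset, PMF.ofFinset_apply, if_pos hA, ENNReal.toReal_ofReal]
    exact binomExp_weight_nonneg (by positivity) (pow_le_one₀ (by norm_num) (by norm_num)) s A
  · intro A _ hA
    rw [randSubset, PMF.ofFinset_apply, if_neg hA]
    simp

end RandSubset

/-! ### Conditional samples -/

section Oracle

variable {Ω : Type} [Fintype Ω]

lemma IsCondOracle.apply_univ {μ : PMF Ω} {O : Set Ω → PMF Ω} (h : IsCondOracle μ O) :
    O Set.univ = μ := by
  obtain ⟨x, hx⟩ := μ.support_nonempty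
  rw [h Set.univ ⟨x, Set.mem_univ x, hx⟩]
  ext y
  have hμ := μ.tsum_coe
  rw [tsum_fintype] at hμ
  rw [PMF.filter_apply]
  simp [hμ]

/-- The probability that a conditional sample hits `x`. -/
lemma IsCondOracle.toReal_apply {μ : PMF Ω} {O : Set Ω → PMF Ω} (h : IsCondOracle μ O)
    {B : Finset Ω} {x : Ω} (hx : x ∈ B) (hpos : 0 < ∑ y ∈ B, (μ y).toReal) :
    (O B x).toReal = (μ x).toReal / ∑ y ∈ B, (μ y).toReal := by
  obtain ⟨y, hy, hy0⟩ := Finset.exists_ne_zero_of_sum_ne_zero hpos.ne'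
  have hex : ∃ a ∈ (B : Set Ω), a ∈ μ.support :=
    ⟨y, hy, by rw [PMF.mem_support_iff]; intro h0; simp [h0] at hy0⟩
  rw [h B hex, PMF.filter_apply, tsum_fintype, ENNReal.toReal_mul, ENNReal.toReal_inv,
    Set.indicator_of_mem (by exact_mod_cast hx), div_eq_mul_inv]
  congr 2
  rw [Finset.sum_indicator_subset _ (Finset.subset_univ B),
    ENNReal.toReal_sum (fun a _ => PMF.apply_ne_top _ _)]

end Oracle

/-! ### Comparing two conditional distributions at one element -/

section Compare

variable {ι Ω : Type} [DecidableEq Ω]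

/-- Sample `n` times from the oracles `i` and `j` conditioned on `B`, count the hits of `x` with
opposite signs, starting from `c`, and accept if the final count is below `thr` in absolute
value. -/
noncomputable def compareLoop (i j : ι) (x : Ω) (B : Set Ω) (thr : ℝ) :
    ℕ → ℤ → CondAlg ι Ω Bool
  | 0, c => .output (decide (|(c : ℝ)| < thr))
  | n + 1, c => .query i B fun u => .query j B fun v =>
      compareLoop i j x B thr n (c + (if u = x then 1 else 0) - (if v = x then 1 else 0))

lemma maxQueries_compareLoop (i j : ι) (x : Ω) (B : Set Ω) (thr : ℝ) (n : ℕ) (c : ℤ) :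
    (compareLoop i j x B thr n c).maxQueries ≤ (2 * n : ℕ) := by
  induction n generalizing c with
  | zero => simp [compareLoop, CondAlg.maxQueries]
  | succ n ih =>
    rw [compareLoop]
    exact CondAlg.maxQueries_query _ _ _ fun u => CondAlg.maxQueries_query _ _ _ fun v => ih _

variable [Fintype Ω]

lemma sum_toReal_mul_ite (p : PMF Ω) (x : Ω) (g h : ℝ) :
    ∑ u, (p u).toReal * (if u = x then g else h) =
      (p x).toReal * g + (1 - (p x).toReal) * h := by
  have h1 : ∀ u, (p u).toReal * (if u = x then g else h) =
      (p u).toReal * h + if u = x then (p u).toReal * (g - h) else 0 := fun u => by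
    split_ifs <;> ring
  simp only [h1]
  rw [Finset.sum_add_distrib, ← Finset.sum_mul, sum_toReal_eq_one, Finset.sum_ite_eq']
  simp only [Finset.mem_univ, if_true]
  ring

lemma acc_compareLoop_succ (O : ι → Set Ω → PMF Ω) (i j : ι) (x : Ω) (B : Set Ω) (thr : ℝ)
    (n : ℕ) (c : ℤ) :
    (compareLoop i j x B thr (n + 1) c).acc O =
      (O i B x).toReal * ((O j B x).toReal * (compareLoop i j x B thr n c).acc O +
        (1 - (O j B x).toReal) * (compareLoop i j x B thr n (c + 1)).acc O) +
      (1 - (O i B x).toReal) * ((O j B x).toReal * (compareLoop i j x B thr n (c - 1)).acc O +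
        (1 - (O j B x).toReal) * (compareLoop i j x B thr n c).acc O) := by
  have h2 : ∀ c' : ℤ, ∑ v, (O j B v).toReal *
      (compareLoop i j x B thr n (c' - (if v = x then 1 else 0))).acc O =
      (O j B x).toReal * (compareLoop i j x B thr n (c' - 1)).acc O +
        (1 - (O j B x).toReal) * (compareLoop i j x B thr n c').acc O := fun c' => by
    rw [← sum_toReal_mul_ite]
    refine Finset.sum_congr rfl fun v _ => ?_
    split_ifs <;> simp
  rw [compareLoop, CondAlg.acc_query]
  simp only [CondAlg.acc_query, h2]
  rw [← sum_toReal_mul_ite]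
  refine Finset.sum_congr rfl fun u _ => ?_
  split_ifs <;> simp

lemma toReal_apply_le_one {α : Type*} (p : PMF α) (a : α) : (p a).toReal ≤ 1 :=
  ENNReal.toReal_le_of_le_ofReal zero_le_one (by simpa using PMF.coe_le_one _ _)

/-- Chernoff bound for the comparison of equal probabilities. -/
lemma one_sub_acc_compareLoop_le (O : ι → Set Ω → PMF Ω) (i j : ι) (x : Ω) (B : Set Ω)
    (heq : O i B x = O j B x) (thr l : ℝ) (hl : 0 ≤ l) (n : ℕ) (c : ℤ) :
    1 - (compareLoop i j x B thr n c).acc O ≤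
      Real.exp (-l * thr) * (Real.exp (l * c) + Real.exp (-(l * c))) * Real.cosh l ^ n := by
  induction n generalizing c with
  | zero =>
    simp only [compareLoop, CondAlg.acc_output, pow_zero, mul_one, decide_eq_true_eq]
    split_ifs with h
    · simp only [sub_self]; positivity
    · rw [not_lt] at h
      have h1 : Real.exp (l * thr) ≤ Real.exp (l * c) + Real.exp (-(l * c)) := by
        rcases le_abs'.1 h with h | h
        · have : Real.exp (l * thr) ≤ Real.exp (-(l * c)) := Real.exp_le_exp.2 (by nlinarith)
          linarith [Real.exp_pos (l * c)]
        · have : Real.exp (l * thr) ≤ Real.exp (l * c) := Real.exp_le_exp.2 (by nlinarith)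
          linarith [Real.exp_pos (-(l * c))]
      calc (1 : ℝ) - 0 = Real.exp (-l * thr) * Real.exp (l * thr) := by
            rw [← Real.exp_add]; simp
        _ ≤ _ := mul_le_mul_of_nonneg_left h1 (Real.exp_pos _).le
  | succ n ih =>
    rw [acc_compareLoop_succ, ← heq]
    set f := (O i B x).toReal with hf
    have hf0 : 0 ≤ f := ENNReal.toReal_nonneg
    have hf1 : f ≤ 1 := toReal_apply_le_one _ _
    have hff : 0 ≤ f * (1 - f) := mul_nonneg hf0 (by linarith)
    have i0 := ih c
    have ip := ih (c + 1)
    have im := ih (c - 1)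
    set F0 := (compareLoop i j x B thr n c).acc O
    set Fp := (compareLoop i j x B thr n (c + 1)).acc O
    set Fm := (compareLoop i j x B thr n (c - 1)).acc O
    push_cast at ip im
    rw [show l * ((c : ℝ) + 1) = l * c + l by ring, neg_add, Real.exp_add, Real.exp_add] at ip
    rw [show l * ((c : ℝ) - 1) = l * c + -l by ring, neg_add, neg_neg, Real.exp_add,
      Real.exp_add] at im
    set X := Real.exp (l * c)
    set Y := Real.exp (-(l * c))
    set E := Real.exp (-l * thr)
    have hX : 0 < X := Real.exp_pos _
    have hY : 0 < Y := Real.exp_pos _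
    have hE : 0 < E := Real.exp_pos _
    have hch : Real.exp l + Real.exp (-l) = 2 * Real.cosh l := by rw [Real.cosh_eq]; ring
    have hc1 : 1 ≤ Real.cosh l := Real.one_le_cosh l
    set C := Real.cosh l
    have hq : f * (1 - f) ≤ 1 / 4 := by nlinarith [sq_nonneg (f - 1 / 2)]
    have hK : 0 < E * (X + Y) * C ^ n := by positivity
    calc 1 - (f * (f * F0 + (1 - f) * Fp) + (1 - f) * (f * Fm + (1 - f) * F0))
        = (1 - 2 * (f * (1 - f))) * (1 - F0) + f * (1 - f) * ((1 - Fp) + (1 - Fm)) := by ring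
      _ ≤ (1 - 2 * (f * (1 - f))) * (E * (X + Y) * C ^ n) + f * (1 - f) *
          (E * (X * Real.exp l + Y * Real.exp (-l)) * C ^ n +
            E * (X * Real.exp (-l) + Y * Real.exp l) * C ^ n) :=
          add_le_add (mul_le_mul_of_nonneg_left i0 (by linarith))
            (mul_le_mul_of_nonneg_left (add_le_add ip im) hff)
      _ = (1 - 2 * (f * (1 - f))) * (E * (X + Y) * C ^ n) + f * (1 - f) *
          (E * (X + Y) * C ^ n * (Real.exp l + Real.exp (-l))) := by ring
      _ = (E * (X + Y) * C ^ n) * (1 + 2 * (f * (1 - f)) * (C - 1)) := by rw [hch]; ring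
      _ ≤ (E * (X + Y) * C ^ n) * C := by
          refine mul_le_mul_of_nonneg_left ?_ hK.le
          nlinarith
      _ = _ := by ring

/-- If both oracles hit `x` with the same probability, the comparison accepts almost surely. -/
lemma le_acc_compareLoop (O : ι → Set Ω → PMF Ω) (i j : ι) (x : Ω) (B : Set Ω)
    (heq : O i B x = O j B x) {t : ℝ} (ht : 0 ≤ t) (n : ℕ) :
    1 - 2 * Real.exp (-(n * t ^ 2 / 8)) ≤ (compareLoop i j x B (n * t / 2) n 0).acc O := by
  -- The exponent is optimal up to a constant at `l = t / 2`.
  have h := one_sub_acc_compareLoop_le O i j x B heq (n * t / 2) (t / 2) (by linarith) n 0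
  have h2 : Real.cosh (t / 2) ^ n ≤ Real.exp (n * ((t / 2) ^ 2 / 2)) := by
    rw [Real.exp_nat_mul]
    exact pow_le_pow_left₀ (Real.cosh_pos _).le (Real.cosh_le_exp_half_sq _) n
  have h3 : Real.exp (-(t / 2) * (n * t / 2)) * (Real.exp (t / 2 * (0 : ℤ)) +
      Real.exp (-(t / 2 * (0 : ℤ)))) * Real.cosh (t / 2) ^ n ≤
      Real.exp (-(t / 2) * (n * t / 2)) * 2 * Real.exp (n * ((t / 2) ^ 2 / 2)) := by
    have : Real.exp (t / 2 * (0 : ℤ)) + Real.exp (-(t / 2 * (0 : ℤ))) = 2 := by norm_num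
    rw [this]
    exact mul_le_mul_of_nonneg_left h2 (by positivity)
  have h4 : Real.exp (-(t / 2) * (n * t / 2)) * 2 * Real.exp (n * ((t / 2) ^ 2 / 2)) =
      2 * Real.exp (-(n * t ^ 2 / 8)) := by
    rw [mul_comm _ (2 : ℝ), mul_assoc, ← Real.exp_add]
    congr 2
    ring
  linarith

/-- Second moment bound for the comparison of different probabilities; `D` is the centre around
which the moment is taken. -/
lemma acc_compareLoop_le_sq (O : ι → Set Ω → PMF Ω) (i j : ι) (x : Ω) (B : Set Ω)
    {thr D : ℝ} (hthr : 0 < thr) (hD : 2 * thr ≤ |D|) (n : ℕ) (c : ℤ) :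
    (compareLoop i j x B thr n c).acc O ≤
      ((c + n * ((O i B x).toReal - (O j B x).toReal) - D) ^ 2 + n) / thr ^ 2 := by
  induction n generalizing c with
  | zero =>
    simp only [compareLoop, CondAlg.acc_output, decide_eq_true_eq]
    split_ifs with h
    · rw [le_div_iff₀ (by positivity), one_mul]
      have h1 : thr ≤ |(c : ℝ) - D| := by
        have := abs_sub_abs_le_abs_sub D (c : ℝ)
        rw [abs_sub_comm] at this
        linarith
      have h2 := pow_le_pow_left₀ hthr.le h1 2
      rw [sq_abs] at h2
      simpa using h2
    · positivity
  | succ n ih =>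
    rw [acc_compareLoop_succ]
    have i0 := ih c
    have ip := ih (c + 1)
    have im := ih (c - 1)
    set f := (O i B x).toReal
    set g := (O j B x).toReal
    have hf0 : 0 ≤ f := ENNReal.toReal_nonneg
    have hf1 : f ≤ 1 := toReal_apply_le_one _ _
    have hg0 : 0 ≤ g := ENNReal.toReal_nonneg
    have hg1 : g ≤ 1 := toReal_apply_le_one _ _
    set F0 := (compareLoop i j x B thr n c).acc O
    set Fp := (compareLoop i j x B thr n (c + 1)).acc O
    set Fm := (compareLoop i j x B thr n (c - 1)).acc O
    rw [le_div_iff₀ (by positivity)] at i0 ip im ⊢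
    push_cast at ip im ⊢
    have hfg : 0 ≤ f * (1 - g) := mul_nonneg hf0 (by linarith)
    have hgf : 0 ≤ (1 - f) * g := mul_nonneg (by linarith) hg0
    have hrest : 0 ≤ f * g + (1 - f) * (1 - g) :=
      add_nonneg (mul_nonneg hf0 hg0) (mul_nonneg (by linarith) (by linarith))
    have e0 := mul_le_mul_of_nonneg_left i0 hrest
    have ep := mul_le_mul_of_nonneg_left ip hfg
    have em := mul_le_mul_of_nonneg_left im hgf
    calc (f * (g * F0 + (1 - g) * Fp) + (1 - f) * (g * Fm + (1 - g) * F0)) * thr ^ 2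
        = (f * g + (1 - f) * (1 - g)) * (F0 * thr ^ 2) + f * (1 - g) * (Fp * thr ^ 2) +
          (1 - f) * g * (Fm * thr ^ 2) := by ring
      _ ≤ _ := add_le_add (add_le_add e0 ep) em
      _ = (c + (n + 1) * (f - g) - D) ^ 2 + n + (f * (1 - f) + g * (1 - g)) := by ring
      _ ≤ _ := by nlinarith [sq_nonneg (f - 1 / 2), sq_nonneg (g - 1 / 2)]

/-- If the oracles hit `x` with probabilities that differ by `t`, then `8 / t ^ 2` samples
suffice to reject with probability one half. -/
lemma acc_compareLoop_le_half (O : ι → Set Ω → PMF Ω) (i j : ι) (x : Ω) (B : Set Ω) {t : ℝ}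
    (ht : 0 < t) (hdiff : t ≤ |(O i B x).toReal - (O j B x).toReal|) {n : ℕ}
    (hn : 8 / t ^ 2 ≤ n) : (compareLoop i j x B (n * t / 2) n 0).acc O ≤ 1 / 2 := by
  have hn0 : (0 : ℝ) < n := lt_of_lt_of_le (by positivity) hn
  have h := acc_compareLoop_le_sq O i j x B (thr := n * t / 2)
    (D := n * ((O i B x).toReal - (O j B x).toReal)) (by positivity)
    (by rw [abs_mul, abs_of_pos hn0]; nlinarith) n 0
  refine h.trans ?_
  rw [div_le_iff₀ (by positivity)]
  rw [div_le_iff₀ (by positivity)] at hn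
  push_cast
  nlinarith

end Compare

/-! ### Noisy binary search -/

section Search

/-- A weighted median of `w 0`, …, `w (J - 1)`. -/
noncomputable def weightedMedian (J : ℕ) (w : ℕ → ℝ) : ℕ :=
  sInf {m | ∑ j ∈ Finset.range J, w j ≤ 2 * ∑ j ∈ Finset.range J with j ≤ m, w j}

/-- The weights after the answer `yes` (the target is below `m`) or `no` (it is above `m`). -/
noncomputable def reweight (m : ℕ) (yes : Bool) (w : ℕ → ℝ) : ℕ → ℝ :=
  fun j => if (if yes then j < m else m < j) then 3 / 2 * w j else 1 / 2 * w j

lemma sum_lt_weightedMedian_le (J : ℕ) (w : ℕ → ℝ) (hw : ∀ j, 0 ≤ w j) :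
    2 * ∑ j ∈ Finset.range J with j < weightedMedian J w, w j ≤ ∑ j ∈ Finset.range J, w j := by
  rcases Nat.eq_zero_or_pos (weightedMedian J w) with h | h
  · rw [h]
    simpa using Finset.sum_nonneg fun j _ => hw j
  · have hlt : weightedMedian J w - 1 < weightedMedian J w := by omega
    have := Nat.notMem_of_lt_sInf hlt
    simp only [Set.mem_ofPred_eq, not_le] at this
    refine le_trans (le_of_eq ?_) this.le
    congr 2
    ext j
    simp only [Finset.mem_filter]
    have : j < weightedMedian J w ↔ j ≤ weightedMedian J w - 1 := by omega
    rw [this]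

lemma sum_weightedMedian_lt_le (J : ℕ) (w : ℕ → ℝ) (hw : ∀ j, 0 ≤ w j) :
    2 * ∑ j ∈ Finset.range J with weightedMedian J w < j, w j ≤ ∑ j ∈ Finset.range J, w j := by
  have hne : {m | ∑ j ∈ Finset.range J, w j ≤
      2 * ∑ j ∈ Finset.range J with j ≤ m, w j}.Nonempty := by
    refine ⟨J, ?_⟩
    have : (Finset.range J).filter (fun j => j ≤ J) = Finset.range J :=
      Finset.filter_true_of_mem fun j hj => (Finset.mem_range.1 hj).le
    rw [Set.mem_ofPred_eq, this]
    linarith [Finset.sum_nonneg fun j (_ : j ∈ Finset.range J) => hw j]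
  have h := Nat.sInf_mem hne
  rw [Set.mem_ofPred_eq, ← weightedMedian] at h
  have h2 := Finset.sum_filter_add_sum_filter_not (Finset.range J)
    (fun j => j ≤ weightedMedian J w) w
  simp only [not_le] at h2
  linarith

lemma reweight_nonneg (m : ℕ) (yes : Bool) {w : ℕ → ℝ} (hw : ∀ j, 0 ≤ w j) (j : ℕ) :
    0 ≤ reweight m yes w j := by
  have := hw j
  unfold reweight
  split_ifs <;> positivity

/-- Reweighting around the median does not increase the total weight. -/
lemma sum_reweight_le (J : ℕ) (yes : Bool) (w : ℕ → ℝ) (hw : ∀ j, 0 ≤ w j) :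
    ∑ j ∈ Finset.range J, reweight (weightedMedian J w) yes w j ≤ ∑ j ∈ Finset.range J, w j := by
  have key : ∀ p : ℕ → Prop, ∀ [DecidablePred p],
      2 * ∑ j ∈ Finset.range J with p j, w j ≤ ∑ j ∈ Finset.range J, w j →
      ∑ j ∈ Finset.range J, (if p j then 3 / 2 * w j else 1 / 2 * w j) ≤
        ∑ j ∈ Finset.range J, w j := by
    intro p _ h
    have h1 : ∀ j, (if p j then 3 / 2 * w j else 1 / 2 * w j) =
        1 / 2 * w j + if p j then w j else 0 := fun j => by split_ifs <;> ring
    simp only [h1]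
    rw [Finset.sum_add_distrib, ← Finset.mul_sum, ← Finset.sum_filter]
    linarith
  cases yes
  · simpa [reweight] using key _ (sum_weightedMedian_lt_le J w hw)
  · simpa [reweight] using key _ (sum_lt_weightedMedian_le J w hw)

variable {ι Ω : Type} [DecidableEq Ω] [Fintype Ω]

/-- Noisy binary search for a level `j` at which a random set of density `2⁻ʲ` balances `x`.
In each round the weighted median `m` is tested: a sample conditioned on `x` and a random set of
density `2⁻ᵐ` is drawn, and the levels on the side to which the answer points gain weight. After
the given number of rounds, continue with the median. -/
noncomputable def search (i : ι) (x : Ω) (J : ℕ) (next : ℕ → CondAlg ι Ω Bool) :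
    ℕ → (ℕ → ℝ) → CondAlg ι Ω Bool
  | 0, w => next (weightedMedian J w)
  | t + 1, w => .coin (randSubset (weightedMedian J w) (Finset.univ.erase x)) fun A =>
      .query i (insert x A : Finset Ω) fun y =>
        search i x J next t (reweight (weightedMedian J w) (decide (y = x)) w)

lemma maxQueries_search (i : ι) (x : Ω) (J : ℕ) (next : ℕ → CondAlg ι Ω Bool) {q : ℕ}
    (h : ∀ j, (next j).maxQueries ≤ q) (t : ℕ) (w : ℕ → ℝ) :
    (search i x J next t w).maxQueries ≤ (q + t : ℕ) := by
  induction t generalizing w with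
  | zero => exact h _
  | succ t ih =>
    rw [search]
    exact CondAlg.maxQueries_coin _ _ fun A => CondAlg.maxQueries_query _ _ _ fun y => ih _

/-- The probability that a sample conditioned on `x` and a random set of density `2⁻ᵐ` is `x`. -/
noncomputable def hitProb (O : ι → Set Ω → PMF Ω) (i : ι) (x : Ω) (m : ℕ) : ℝ :=
  binomExp ((1 / 2 : ℝ) ^ m) (Finset.univ.erase x)
    fun A => (O i (insert x A : Finset Ω) x).toReal

lemma hitProb_nonneg (O : ι → Set Ω → PMF Ω) (i : ι) (x : Ω) (m : ℕ) : 0 ≤ hitProb O i x m :=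
  binomExp_nonneg (by positivity) (pow_le_one₀ (by norm_num) (by norm_num)) _
    fun _ _ => ENNReal.toReal_nonneg

lemma hitProb_le_one (O : ι → Set Ω → PMF Ω) (i : ι) (x : Ω) (m : ℕ) : hitProb O i x m ≤ 1 := by
  rw [← binomExp_const ((1 / 2 : ℝ) ^ m) (Finset.univ.erase x) 1]
  exact binomExp_mono (by positivity) (pow_le_one₀ (by norm_num) (by norm_num)) _
    fun _ _ => toReal_apply_le_one _ _

lemma acc_search_succ (O : ι → Set Ω → PMF Ω) (i : ι) (x : Ω) (J : ℕ)
    (next : ℕ → CondAlg ι Ω Bool) (t : ℕ) (w : ℕ → ℝ) :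
    (search i x J next (t + 1) w).acc O =
      hitProb O i x (weightedMedian J w) *
        (search i x J next t (reweight (weightedMedian J w) true w)).acc O +
      (1 - hitProb O i x (weightedMedian J w)) *
        (search i x J next t (reweight (weightedMedian J w) false w)).acc O := by
  rw [search, CondAlg.acc_coin]
  simp only [CondAlg.acc_query]
  rw [sum_randSubset_mul]
  set Fy := (search i x J next t (reweight (weightedMedian J w) true w)).acc O
  set Fn := (search i x J next t (reweight (weightedMedian J w) false w)).acc O
  have h : ∀ A : Finset Ω, ∑ y, (O i (insert x A : Finset Ω) y).toReal *
      (search i x J next t (reweight (weightedMedian J w) (decide (y = x)) w)).acc O =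
      Fn + (Fy - Fn) * (O i (insert x A : Finset Ω) x).toReal := fun A => by
    have := sum_toReal_mul_ite (O i (insert x A : Finset Ω)) x Fy Fn
    rw [show Fn + (Fy - Fn) * (O i (insert x A : Finset Ω) x).toReal =
      (O i (insert x A : Finset Ω) x).toReal * Fy +
        (1 - (O i (insert x A : Finset Ω) x).toReal) * Fn by ring, ← this]
    refine Finset.sum_congr rfl fun y _ => ?_
    by_cases hy : y = x <;> simp [hy, Fy, Fn]
  simp only [h]
  rw [binomExp_add, binomExp_const, binomExp_const_mul, hitProb]
  ring

/-- The search spends a constant fraction of the time in the zone `mid` around the target `z`.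
Outside `mid` the test points to the target with probability at least `4 / 5`. The potential
`log (W / w z)`, where `W` is the total weight, stays nonnegative; a round outside `mid` decreases
it by a constant in expectation, and a round in `mid` increases it by at most `log 2`. If the
continuation rejects in `mid` with probability one half, this bounds the sum of the rejection
probabilities over all stopping times. -/
lemma sum_one_sub_acc_search_ge (O : ι → Set Ω → PMF Ω) (i : ι) (x : Ω) {J z : ℕ} (hz : z < J)
    (mid : Set ℕ)
    (hmid : ∀ m ∉ mid, (z < m ∧ 4 / 5 ≤ hitProb O i x m) ∨ (m < z ∧ hitProb O i x m ≤ 1 / 5))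
    (next : ℕ → CondAlg ι Ω Bool) (hnext : ∀ m ∈ mid, (next m).acc O ≤ 1 / 2) (T : ℕ)
    (w : ℕ → ℝ) (hw : ∀ j, 0 ≤ w j) (hwz : 0 < w z) :
    (4 / 5 * Real.log (3 / 2) - 1 / 5 * Real.log 2) * T
        - Real.log ((∑ j ∈ Finset.range J, w j) / w z) ≤
      8 / 5 * Real.log 3 * ∑ t ∈ Finset.range T, (1 - (search i x J next t w).acc O) := by
  have tot : ∀ v : ℕ → ℝ, (∀ j, 0 ≤ v j) → v z ≤ ∑ j ∈ Finset.range J, v j := fun v hv =>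
    Finset.single_le_sum (f := v) (fun j _ => hv j) (Finset.mem_range.2 hz)
  induction T generalizing w with
  | zero =>
    have : 0 ≤ Real.log ((∑ j ∈ Finset.range J, w j) / w z) :=
      Real.log_nonneg ((one_le_div hwz).2 (tot w hw))
    simpa using this
  | succ T ih =>
    set m := weightedMedian J w with hm
    set W := ∑ j ∈ Finset.range J, w j with hW
    have hWpos : 0 < W := hwz.trans_le (tot w hw)
    set h := hitProb O i x m
    have h0 : 0 ≤ h := hitProb_nonneg O i x m
    have h1 : h ≤ 1 := hitProb_le_one O i x m
    set Sy := ∑ t ∈ Finset.range T, (1 - (search i x J next t (reweight m true w)).acc O)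
    set Sn := ∑ t ∈ Finset.range T, (1 - (search i x J next t (reweight m false w)).acc O)
    have hsum : ∑ t ∈ Finset.range (T + 1), (1 - (search i x J next t w).acc O) =
        h * Sy + (1 - h) * Sn + (1 - (next m).acc O) := by
      rw [Finset.sum_range_succ', search, Finset.mul_sum, Finset.mul_sum,
        ← Finset.sum_add_distrib]
      congr 1
      refine Finset.sum_congr rfl fun t _ => ?_
      rw [acc_search_succ]
      ring
    have hlog3 : Real.log (3 / 2) = Real.log 3 - Real.log 2 :=
      Real.log_div (by norm_num) (by norm_num)
    have hl2 : 0 < Real.log 2 := Real.log_pos (by norm_num)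
    have hl32 : 0 < Real.log (3 / 2) := Real.log_pos (by norm_num)
    have hl3 : 0 < Real.log 3 := Real.log_pos (by norm_num)
    -- the effect of one answer on the potential
    have pot : ∀ (yes : Bool) (f : ℝ), 0 < f → reweight m yes w z = f * w z →
        Real.log ((∑ j ∈ Finset.range J, reweight m yes w j) / reweight m yes w z) ≤
          Real.log (W / w z) - Real.log f := by
      intro yes f hf hfz
      rw [← Real.log_div (by positivity) hf.ne', hfz]
      have hpos : 0 < ∑ j ∈ Finset.range J, reweight m yes w j :=
        lt_of_lt_of_le (by rw [hfz]; positivity) (tot _ (reweight_nonneg m yes hw))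
      refine Real.log_le_log (by positivity) ?_
      rw [div_div, mul_comm f]
      exact div_le_div_of_nonneg_right (sum_reweight_le J yes w hw) (by positivity)
    have half : Real.log (1 / 2) = -Real.log 2 := by rw [one_div, Real.log_inv]
    have pos_of : ∀ (yes : Bool), 0 < reweight m yes w z := fun yes => by
      unfold reweight; split_ifs <;> positivity
    have iy := ih (reweight m true w) (reweight_nonneg m true hw) (pos_of true)
    have iN := ih (reweight m false w) (reweight_nonneg m false hw) (pos_of false)
    set c0 := 4 / 5 * Real.log (3 / 2) - 1 / 5 * Real.log 2 with hc0
    rw [hsum]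
    push_cast
    have hacc : (next m).acc O ≤ 1 := CondAlg.acc_le_one _ _
    -- combine bounds `-gy`, `-gn` for the change of the potential after the two answers
    have combine : ∀ gy gn : ℝ,
        Real.log ((∑ j ∈ Finset.range J, reweight m true w j) / reweight m true w z) ≤
          Real.log (W / w z) - gy →
        Real.log ((∑ j ∈ Finset.range J, reweight m false w j) / reweight m false w z) ≤
          Real.log (W / w z) - gn →
        c0 ≤ h * gy + (1 - h) * gn + 8 / 5 * Real.log 3 * (1 - (next m).acc O) →
        c0 * (T + 1) - Real.log (W / w z) ≤
          8 / 5 * Real.log 3 * (h * Sy + (1 - h) * Sn + (1 - (next m).acc O)) := by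
      intro gy gn hy hn hc
      have e1 := mul_le_mul_of_nonneg_left
        (show c0 * T - (Real.log (W / w z) - gy) ≤ 8 / 5 * Real.log 3 * Sy by linarith) h0
      have e2 := mul_le_mul_of_nonneg_left
        (show c0 * T - (Real.log (W / w z) - gn) ≤ 8 / 5 * Real.log 3 * Sn by linarith)
        (sub_nonneg.2 h1)
      nlinarith
    by_cases hmm : m ∈ mid
    · have lower : ∀ yes : Bool,
          Real.log ((∑ j ∈ Finset.range J, reweight m yes w j) / reweight m yes w z) ≤
            Real.log (W / w z) - (-Real.log 2) := by
        intro yes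
        by_cases hc : (if yes then z < m else m < z)
        · have := pot yes (3 / 2) (by norm_num) (by unfold reweight; rw [if_pos hc])
          linarith
        · have := pot yes (1 / 2) (by norm_num) (by unfold reweight; rw [if_neg hc])
          linarith
      refine combine _ _ (lower true) (lower false) ?_
      have := hnext m hmm
      nlinarith
    · have hB : 0 ≤ 8 / 5 * Real.log 3 * (1 - (next m).acc O) :=
        mul_nonneg (by positivity) (by linarith)
      rcases hmid m hmm with ⟨hlt, hge⟩ | ⟨hlt, hle⟩
      · have hy := pot true (3 / 2) (by norm_num) (by simp [reweight, hlt])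
        have hn := pot false (1 / 2) (by norm_num) (by simp [reweight, hlt.not_gt])
        refine combine _ _ hy hn ?_
        rw [half]
        nlinarith
      · have hy := pot true (1 / 2) (by norm_num) (by simp [reweight, hlt.not_gt])
        have hn := pot false (3 / 2) (by norm_num) (by simp [reweight, hlt])
        refine combine _ _ hy hn ?_
        rw [half]
        nlinarith

/-- The search that starts from equal weights and stops at a uniformly random time. -/
noncomputable def randomSearch (i : ι) (x : Ω) (J T : ℕ) (next : ℕ → CondAlg ι Ω Bool) :
    CondAlg ι Ω Bool :=
  .coin (PMF.uniformOfFintype (Fin (T + 1))) fun t => search i x J next t fun _ => 1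

lemma maxQueries_randomSearch (i : ι) (x : Ω) (J T : ℕ) (next : ℕ → CondAlg ι Ω Bool) {q : ℕ}
    (h : ∀ j, (next j).maxQueries ≤ q) :
    (randomSearch i x J T next).maxQueries ≤ (q + T : ℕ) := by
  refine CondAlg.maxQueries_coin _ _ fun t => ?_
  refine (maxQueries_search i x J next h t _).trans ?_
  exact_mod_cast Nat.add_le_add_left (Nat.lt_succ_iff.1 t.2) q

lemma acc_randomSearch_le (O : ι → Set Ω → PMF Ω) (i : ι) (x : Ω) {J z T : ℕ} (hz : z < J)
    (mid : Set ℕ)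
    (hmid : ∀ m ∉ mid, (z < m ∧ 4 / 5 ≤ hitProb O i x m) ∨ (m < z ∧ hitProb O i x m ≤ 1 / 5))
    (next : ℕ → CondAlg ι Ω Bool) (hnext : ∀ m ∈ mid, (next m).acc O ≤ 1 / 2)
    (hT : 10 * Real.log J ≤ T) : (randomSearch i x J T next).acc O ≤ 24 / 25 := by
  have h := sum_one_sub_acc_search_ge O i x hz mid hmid next hnext (T + 1) (fun _ => 1)
    (fun _ => zero_le_one) one_pos
  rw [Finset.sum_const, Finset.card_range, nsmul_eq_mul, mul_one, div_one] at h
  rw [randomSearch, CondAlg.acc_coin]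
  simp only [PMF.uniformOfFintype_apply, Fintype.card_fin]
  rw [Finset.sum_range, Finset.sum_sub_distrib] at h
  simp only [Finset.sum_const, Finset.card_univ, Fintype.card_fin, nsmul_eq_mul, mul_one] at h
  rw [← Finset.mul_sum, ENNReal.toReal_inv, ENNReal.toReal_natCast, inv_mul_le_iff₀ (by positivity)]
  set S := ∑ t : Fin (T + 1), (search i x J next t fun _ => 1).acc O
  have hlog3 : Real.log (3 / 2) = Real.log 3 - Real.log 2 :=
    Real.log_div (by norm_num) (by norm_num)
  have l2 := Real.log_two_lt_d9
  have l3 := Real.log_three_lt_d9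
  have l3' := Real.log_three_gt_d9
  push_cast at h ⊢
  rw [hlog3] at h
  have hTT : (0 : ℝ) ≤ T := Nat.cast_nonneg T
  by_contra hcon
  push Not at hcon
  nlinarith

end Search

/-! ### Random sets around a witness of the distance -/

section Witness

variable {Ω : Type}

lemma abs_binomExp_le {α : Type*} {p : ℝ} (h0 : 0 ≤ p) (h1 : p ≤ 1) (s : Finset α)
    (F : Finset α → ℝ) : |binomExp p s F| ≤ binomExp p s fun A => |F A| := by
  refine (Finset.abs_sum_le_sum_abs _ _).trans (Finset.sum_le_sum fun A _ => ?_)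
  rw [abs_mul, abs_of_nonneg (binomExp_weight_nonneg h0 h1 s A)]

/-- Conditioned on `A ∪ {x}`, the probabilities of `x` under `a` and `b` differ by at least `t`,
written without denominators. -/
def Distinguishes (a b : Ω → ℝ) (t : ℝ) (x : Ω) (A : Finset Ω) : Prop :=
  0 < b x + ∑ y ∈ A, b y ∧
    t * ((a x + ∑ y ∈ A, a y) * (b x + ∑ y ∈ A, b y)) ≤
      |a x * ∑ y ∈ A, b y - b x * ∑ y ∈ A, a y|

open Classical in
/-- Young's inequality, with a parameter of order `δ / (a x + b x)²`, at the distinguishing sets,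
and their definition at the others. -/
lemma abs_difference_le {a b : Ω → ℝ} (ha : ∀ y, 0 ≤ a y) (hb : ∀ y, 0 ≤ b y) {δ γ V : ℝ}
    (hδ : 0 < δ) {x : Ω} (hs0 : 0 < a x + b x) (hγV : γ ≤ V) (hV : 0 ≤ V) (A : Finset Ω) :
    |∑ y ∈ A, (a x * b y - b x * a y)| ≤
      (δ * V / 128) * (∑ y ∈ A, (a y + b y) - -(a x + b x)) ^ 2 +
      ((δ / 8) * (∑ y ∈ A, (a y + b y) - 0) ^ 2 +
      (2 * (a x + b x) ^ 2 / δ) *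
        (if Distinguishes a b (δ * γ / 32) x A then (1 : ℝ) else 0)) := by
  rw [Finset.sum_add_distrib, Finset.sum_sub_distrib, ← Finset.mul_sum, ← Finset.mul_sum]
  have hα : 0 ≤ ∑ y ∈ A, a y := Finset.sum_nonneg fun y _ => ha y
  have hβ : 0 ≤ ∑ y ∈ A, b y := Finset.sum_nonneg fun y _ => hb y
  have hax := ha x
  have hbx := hb x
  have hdef : Distinguishes a b (δ * γ / 32) x A ↔ 0 < b x + ∑ y ∈ A, b y ∧
    δ * γ / 32 * ((a x + ∑ y ∈ A, a y) * (b x + ∑ y ∈ A, b y)) ≤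
      |a x * ∑ y ∈ A, b y - b x * ∑ y ∈ A, a y| := Iff.rfl
  generalize ∑ y ∈ A, a y = α at *
  generalize ∑ y ∈ A, b y = β at *
  have hs : ∃ s, s = a x + b x := ⟨_, rfl⟩
  generalize a x = u at *
  generalize b x = v at *
  obtain ⟨s, hs⟩ := hs
  rw [← hs] at hs0 ⊢
  have hDW : |u * β - v * α| ≤ s * (α + β) := by
    have e1 : 0 ≤ u * α := mul_nonneg hax hα
    have e2 : 0 ≤ v * β := mul_nonneg hbx hβ
    have e3 : 0 ≤ u * β := mul_nonneg hax hβ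
    have e4 : 0 ≤ v * α := mul_nonneg hbx hα
    refine abs_le.2 ⟨?_, ?_⟩ <;> rw [hs] <;> linarith
  have hD0 : 0 ≤ |u * β - v * α| := abs_nonneg _
  by_cases hdist : Distinguishes a b (δ * γ / 32) x A
  · have hprod := (hdef.1 hdist)
    rw [if_pos hdist]
    generalize |u * β - v * α| = D at *
    have hy : D ≤ δ / (8 * s ^ 2) * D ^ 2 + 2 * s ^ 2 / δ := by
      have : 0 ≤ δ / (8 * s ^ 2) * (D - 4 * s ^ 2 / δ) ^ 2 := by positivity
      have e : δ / (8 * s ^ 2) * (D - 4 * s ^ 2 / δ) ^ 2 =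
          δ / (8 * s ^ 2) * D ^ 2 - D + 2 * s ^ 2 / δ := by
        field_simp
        ring
      linarith
    have hy2 : δ / (8 * s ^ 2) * D ^ 2 ≤ δ / 8 * (α + β - 0) ^ 2 := by
      have := pow_le_pow_left₀ hD0 hDW 2
      calc δ / (8 * s ^ 2) * D ^ 2 ≤ δ / (8 * s ^ 2) * (s * (α + β)) ^ 2 :=
            mul_le_mul_of_nonneg_left this (by positivity)
        _ = _ := by field_simp; ring
    have hn1 : 0 ≤ (δ * V / 128) * (α + β - -s) ^ 2 := by
      positivity
    linarith
  · rw [if_neg hdist]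
    have hn2 : 0 ≤ (δ / 8) * (α + β - 0) ^ 2 := by positivity
    suffices hsuff : |u * β - v * α| ≤ (δ * V / 128) * (α + β - -s) ^ 2 by linarith
    rw [hdef, not_and_or, not_lt, not_le] at hdist
    rcases hdist with hz | hlt
    · have hv : v = 0 := by linarith
      have hβz : β = 0 := by linarith
      have hn1 : 0 ≤ (δ * V / 128) * (α + β - -s) ^ 2 := by
        positivity
      rw [hv, hβz] at *
      simpa using hn1
    · refine hlt.le.trans ?_
      have hprod : 0 ≤ (u + α) * (v + β) :=
        mul_nonneg (add_nonneg hax hα) (add_nonneg hbx hβ)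
      have hamgm : (u + α) * (v + β) ≤ (α + β - -s) ^ 2 / 4 := by
        rw [hs]
        nlinarith [sq_nonneg ((u + α) - (v + β))]
      have hδV := mul_le_mul_of_nonneg_left hγV hδ.le
      calc δ * γ / 32 * ((u + α) * (v + β))
          ≤ δ * V / 32 * ((u + α) * (v + β)) :=
            mul_le_mul_of_nonneg_right (by linarith) hprod
        _ ≤ δ * V / 32 * ((α + β - -s) ^ 2 / 4) :=
            mul_le_mul_of_nonneg_left hamgm (by linarith [mul_nonneg hδ.le hV])
        _ = _ := by ring

variable [Fintype Ω] [LinearOrder Ω]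

lemma erase_eq_lighter_union_heavier (w : Ω → ℝ) (x : Ω) :
    Finset.univ.erase x = lighter w Finset.univ x ∪ heavier w Finset.univ x := by
  ext y
  simp only [Finset.mem_erase, Finset.mem_univ, and_true, Finset.mem_union, mem_lighter,
    mem_heavier, true_and]
  constructor
  · intro h
    rcases precedes_or_eq_or_precedes w y x with h' | h' | h'
    · exact Or.inl h'
    · exact absurd h' h
    · exact Or.inr h'
  · rintro (h | h) rfl <;> exact not_precedes_self _ _ h

/-- An element at which the masses `a` and `b` deviate, by a relative amount `δ`, from their
ratio on the lighter elements; together with these it has joint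
mass at least `γ`, to which both contribute comparably. Of the two masses at the element itself,
`a` is the larger one. -/
structure IsWitness (a b : Ω → ℝ) (δ γ : ℝ) (x : Ω) : Prop where
  le : b x ≤ a x
  lowMass_ge : γ ≤ lowMass a b Finset.univ x
  balanced : Balanced a b Finset.univ x
  discrepancy_ge : δ * (lowMass a b Finset.univ x * (a x + b x)) ≤ discrepancy a b Finset.univ x

lemma IsWitness.quarter_le {a b : Ω → ℝ} {δ γ : ℝ} {x : Ω} (h : IsWitness a b δ γ x) :
    γ / 4 ≤ ∑ y ∈ lighter (a + b) Finset.univ x, a y + a x := by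
  have h1 := abs_le.1 h.balanced
  have h2 := h.lowMass_ge
  simp only [lowMass, Finset.sum_add_distrib] at h1 h2
  linarith [h1.1]

lemma lowMass_le_card_mul (a b : Ω → ℝ) (ha : ∀ y, 0 ≤ a y) (hb : ∀ y, 0 ≤ b y) (x : Ω) :
    lowMass a b Finset.univ x ≤ Fintype.card Ω * (a x + b x) := by
  have hx : x ∉ lighter (a + b) Finset.univ x :=
    fun h => not_precedes_self _ _ (mem_lighter.1 h).2
  have : lowMass a b Finset.univ x =
      ∑ y ∈ insert x (lighter (a + b) Finset.univ x), (a y + b y) := by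
    rw [Finset.sum_insert hx, lowMass, add_comm]
  rw [this]
  calc ∑ y ∈ insert x (lighter (a + b) Finset.univ x), (a y + b y)
      ≤ ∑ y ∈ insert x (lighter (a + b) Finset.univ x), (a x + b x) := by
        refine Finset.sum_le_sum fun y hy => ?_
        rcases Finset.mem_insert.1 hy with rfl | hy
        · exact le_rfl
        · exact (mem_lighter.1 hy).2.le
    _ ≤ _ := by
        rw [Finset.sum_const, nsmul_eq_mul]
        refine mul_le_mul_of_nonneg_right ?_ (add_nonneg (ha x) (hb x))
        exact_mod_cast Finset.card_le_univ _

open Classical in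
/-- Among the random sets of lighter elements, whose density is proportional to the mass of the
witness, a fraction of order `δ² γ` is distinguishing: otherwise the mean of the difference
`a x * b A - b x * a A` would be too small, by a second moment bound. -/
lemma binomExp_lighter_distinguishes {a b : Ω → ℝ} (ha : ∀ y, 0 ≤ a y) (hb : ∀ y, 0 ≤ b y)
    (ha1 : ∑ y, a y = 1) (hb1 : ∑ y, b y = 1) {δ γ : ℝ} (hδ : 0 < δ) {x : Ω}
    (h : IsWitness a b δ γ x) (hx : 0 < a x) {p : ℝ}
    (hp : (a x + b x) / 32 ≤ p) (hp' : p ≤ (a x + b x) / 16) (hp1 : p ≤ 1) :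
    δ ^ 2 * γ / 180 ≤ binomExp p (lighter (a + b) Finset.univ x)
      fun A => if Distinguishes a b (δ * γ / 32) x A then 1 else 0 := by
  set L := lighter (a + b) Finset.univ x with hL
  set s := a x + b x with hs
  have hs0 : 0 < s := by linarith [hb x]
  have hp0 : 0 ≤ p := by linarith
  have hw0 : ∀ y, 0 ≤ a y + b y := fun y => add_nonneg (ha y) (hb y)
  set V' := ∑ y ∈ L, (a y + b y) with hV'
  have hV'0 : 0 ≤ V' := Finset.sum_nonneg fun y _ => hw0 y
  have hV'2 : V' ≤ 2 := by
    have : V' ≤ ∑ y, (a y + b y) :=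
      Finset.sum_le_sum_of_subset_of_nonneg (Finset.subset_univ _) fun y _ _ => hw0 y
    rw [Finset.sum_add_distrib, ha1, hb1] at this
    linarith
  have hVV : lowMass a b Finset.univ x = V' + s := rfl
  set V := V' + s with hV
  have hγV : γ ≤ V := h.lowMass_ge
  set P := binomExp p L (fun A => if Distinguishes a b (δ * γ / 32) x A then (1 : ℝ) else 0)
  -- the mean of the difference
  have hmean : δ * V * s ^ 2 / 32 ≤
      binomExp p L (fun A => |∑ y ∈ A, (a x * b y - b x * a y)|) := by
    refine le_trans ?_ (abs_binomExp_le hp0 hp1 L _)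
    rw [binomExp_sum, abs_mul, abs_of_nonneg hp0]
    have hd : |∑ y ∈ L, (a x * b y - b x * a y)| = discrepancy a b Finset.univ x := by
      rw [Finset.sum_sub_distrib, ← Finset.mul_sum, ← Finset.mul_sum]
      rfl
    rw [hd]
    have h1 := h.discrepancy_ge
    rw [hVV] at h1
    have h2 : 0 ≤ δ * (V * s) := by positivity
    calc δ * V * s ^ 2 / 32 = s / 32 * (δ * (V * s)) := by ring
      _ ≤ p * (δ * (V * s)) := mul_le_mul_of_nonneg_right hp h2
      _ ≤ _ := mul_le_mul_of_nonneg_left h1 hp0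
  -- moments of the mass of the random set
  have hsq : p * (1 - p) * ∑ y ∈ L, (a y + b y) ^ 2 ≤ s ^ 2 * V' / 16 := by
    have h1 : ∑ y ∈ L, (a y + b y) ^ 2 ≤ s * V' := by
      rw [hV', Finset.mul_sum]
      refine Finset.sum_le_sum fun y hy => ?_
      have : a y + b y ≤ s := (mem_lighter.1 hy).2.le
      nlinarith [hw0 y]
    have h2 : 0 ≤ ∑ y ∈ L, (a y + b y) ^ 2 := Finset.sum_nonneg fun y _ => sq_nonneg _
    have h3 : p * (1 - p) ≤ s / 16 := by nlinarith
    calc _ ≤ s / 16 * ∑ y ∈ L, (a y + b y) ^ 2 := mul_le_mul_of_nonneg_right h3 h2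
      _ ≤ s / 16 * (s * V') := mul_le_mul_of_nonneg_left h1 (by positivity)
      _ = _ := by ring
  have hpV0 : 0 ≤ p * V' := by positivity
  have hpV : p * V' ≤ s / 16 * V' := mul_le_mul_of_nonneg_right hp' hV'0
  have hm1 : binomExp p L (fun A => (∑ y ∈ A, (a y + b y) - -s) ^ 2) ≤ 7 / 5 * s ^ 2 := by
    rw [binomExp_sum_sub_sq, ← hV']
    have h1 : p * V' - -s ≤ 9 / 8 * s := by nlinarith
    have h2 : (p * V' - -s) ^ 2 ≤ (9 / 8 * s) ^ 2 := pow_le_pow_left₀ (by linarith) h1 2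
    nlinarith [sq_nonneg s]
  have hm2 : binomExp p L (fun A => (∑ y ∈ A, (a y + b y) - 0) ^ 2) ≤ s ^ 2 * V / 14 := by
    rw [binomExp_sum_sub_sq, ← hV', sub_zero]
    have h2 : (p * V') ^ 2 ≤ (s / 16 * V') ^ 2 := pow_le_pow_left₀ hpV0 hpV 2
    have h3 : (s / 16 * V') ^ 2 ≤ s ^ 2 * V' / 128 := by
      have : V' ^ 2 ≤ 2 * V' := by nlinarith
      nlinarith [sq_nonneg s, mul_le_mul_of_nonneg_left this (sq_nonneg s)]
    have h4 : s ^ 2 * V' ≤ s ^ 2 * V := mul_le_mul_of_nonneg_left (by linarith) (sq_nonneg s)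
    have h5 : 0 ≤ s ^ 2 * V' := by positivity
    linarith
  have hpt := fun A (_ : A ⊆ L) => abs_difference_le ha hb hδ hs0 hγV (by positivity) A
  have hall := binomExp_mono hp0 hp1 L hpt
  rw [binomExp_add, binomExp_add, binomExp_const_mul, binomExp_const_mul,
    binomExp_const_mul] at hall
  have k1 := mul_le_mul_of_nonneg_left hm1 (show 0 ≤ δ * V / 128 by positivity)
  have k2 := mul_le_mul_of_nonneg_left hm2 (show 0 ≤ δ / 8 by positivity)
  have k3 : δ * V * s ^ 2 * (1 / 32 - 7 / 640 - 1 / 112) ≤ 2 * s ^ 2 / δ * P := by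
    have e1 : δ * V / 128 * (7 / 5 * s ^ 2) = δ * V * s ^ 2 * (7 / 640) := by ring
    have e2 : δ / 8 * (s ^ 2 * V / 14) = δ * V * s ^ 2 * (1 / 112) := by ring
    linarith
  have k4 : δ ^ 2 * V * (1 / 32 - 7 / 640 - 1 / 112) ≤ 2 * P := by
    have := mul_le_mul_of_nonneg_left k3 (show 0 ≤ δ / s ^ 2 by positivity)
    have e1 : δ / s ^ 2 * (δ * V * s ^ 2 * (1 / 32 - 7 / 640 - 1 / 112)) =
        δ ^ 2 * V * (1 / 32 - 7 / 640 - 1 / 112) := by field_simp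
    have e2 : δ / s ^ 2 * (2 * s ^ 2 / δ * P) = 2 * P := by field_simp
    rwa [e1, e2] at this
  have k5 : δ ^ 2 * γ ≤ δ ^ 2 * V := mul_le_mul_of_nonneg_left hγV (sq_nonneg δ)
  have k6 : 0 ≤ δ ^ 2 * V := by positivity
  linarith

open Classical in
/-- A random set misses all the heavier elements with constant probability, as there are few of
them. -/
lemma binomExp_distinguishes {a b : Ω → ℝ} (ha : ∀ y, 0 ≤ a y) (hb : ∀ y, 0 ≤ b y)
    (ha1 : ∑ y, a y = 1) (hb1 : ∑ y, b y = 1) {δ γ : ℝ} (hδ : 0 < δ) (hγ : 0 ≤ γ) {x : Ω}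
    (h : IsWitness a b δ γ x) (hx : 0 < a x) {p : ℝ}
    (hp : (a x + b x) / 32 ≤ p) (hp' : p ≤ (a x + b x) / 16) (hp1 : p ≤ 1) :
    δ ^ 2 * γ / 256 ≤ binomExp p (Finset.univ.erase x)
      fun A => if Distinguishes a b (δ * γ / 32) x A then 1 else 0 := by
  have hp0 : 0 ≤ p := by linarith [hb x]
  rw [erase_eq_lighter_union_heavier (a + b) x]
  refine le_trans ?_ (le_binomExp_union hp0 hp1 _ _ fun A => by split_ifs <;> norm_num)
  have h1 := binomExp_lighter_distinguishes ha hb ha1 hb1 hδ h hx hp hp' hp1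
  set H := heavier (a + b) Finset.univ x
  have hcard : H.card * (a x + b x) ≤ 2 := by
    calc (H.card : ℝ) * (a x + b x) = ∑ y ∈ H, (a x + b x) := by
          rw [Finset.sum_const, nsmul_eq_mul]
      _ ≤ ∑ y ∈ H, (a y + b y) :=
          Finset.sum_le_sum fun y hy => (mem_heavier.1 hy).2.le
      _ ≤ ∑ y, (a y + b y) := Finset.sum_le_sum_of_subset_of_nonneg (Finset.subset_univ _)
          fun y _ _ => add_nonneg (ha y) (hb y)
      _ = 2 := by rw [Finset.sum_add_distrib, ha1, hb1]; norm_num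
  have hb' : 7 / 8 ≤ (1 - p) ^ H.card := by
    have := one_add_mul_le_pow (a := -p) (by linarith) H.card
    rw [← sub_eq_add_neg] at this
    have h2 : (H.card : ℝ) * p ≤ H.card * ((a x + b x) / 16) :=
      mul_le_mul_of_nonneg_left hp' (Nat.cast_nonneg _)
    linarith
  have h3 : 0 ≤ δ ^ 2 * γ / 180 := by positivity
  nlinarith [mul_le_mul hb' h1 h3 (by linarith : (0 : ℝ) ≤ (1 - p) ^ H.card)]

end Witness

/-! ### The tests of the binary search at a witness -/

section HitProb

variable {ι Ω : Type} [Fintype Ω] [LinearOrder Ω]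

lemma sum_insert_toReal {μ : PMF Ω} {x : Ω} {A : Finset Ω} (hA : A ⊆ Finset.univ.erase x) :
    ∑ y ∈ insert x A, (μ y).toReal = (μ x).toReal + ∑ y ∈ A, (μ y).toReal :=
  Finset.sum_insert fun h => by simpa using hA h

lemma hitProb_eq {μ : PMF Ω} {O : ι → Set Ω → PMF Ω} {i : ι} (h : IsCondOracle μ (O i)) {x : Ω}
    (hx : 0 < (μ x).toReal) (m : ℕ) :
    hitProb O i x m = binomExp ((1 / 2 : ℝ) ^ m) (Finset.univ.erase x)
      fun A => (μ x).toReal / ((μ x).toReal + ∑ y ∈ A, (μ y).toReal) := by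
  refine Finset.sum_congr rfl fun A hA => ?_
  have hA' := sum_insert_toReal (μ := μ) (Finset.mem_powerset.1 hA)
  simp only
  rw [h.toReal_apply (Finset.mem_insert_self x A), hA']
  rw [hA']
  exact add_pos_of_pos_of_nonneg hx (Finset.sum_nonneg fun _ _ => ENNReal.toReal_nonneg)

/-- Sparse random sets are dominated by `x`. -/
lemma hitProb_ge {μ : PMF Ω} {O : ι → Set Ω → PMF Ω} {i : ι} (h : IsCondOracle μ (O i)) {x : Ω}
    (hx : 0 < (μ x).toReal) {m : ℕ} (hm : (1 / 2 : ℝ) ^ m ≤ (μ x).toReal / 8) :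
    4 / 5 ≤ hitProb O i x m := by
  rw [hitProb_eq h hx]
  set u := (μ x).toReal
  set p := (1 / 2 : ℝ) ^ m
  have hp0 : 0 ≤ p := by positivity
  have hp1 : p ≤ 1 := pow_le_one₀ (by norm_num) (by norm_num)
  have h1 : binomExp p (Finset.univ.erase x) (fun A => 1 + (-1 / u) * ∑ y ∈ A, (μ y).toReal) ≤
      binomExp p (Finset.univ.erase x) (fun A => u / (u + ∑ y ∈ A, (μ y).toReal)) := by
    refine binomExp_mono hp0 hp1 _ fun A _ => ?_
    have hA : 0 ≤ ∑ y ∈ A, (μ y).toReal := Finset.sum_nonneg fun _ _ => ENNReal.toReal_nonneg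
    rw [le_div_iff₀ (by positivity)]
    have : (1 + (-1 / u) * ∑ y ∈ A, (μ y).toReal) * (u + ∑ y ∈ A, (μ y).toReal) =
        u - (∑ y ∈ A, (μ y).toReal) ^ 2 / u := by field_simp; ring
    rw [this]
    have : 0 ≤ (∑ y ∈ A, (μ y).toReal) ^ 2 / u := by positivity
    linarith
  rw [binomExp_add, binomExp_const, binomExp_const_mul, binomExp_sum] at h1
  have h2 : ∑ y ∈ Finset.univ.erase x, (μ y).toReal ≤ 1 := by
    rw [← sum_toReal_eq_one μ]
    exact Finset.sum_le_sum_of_subset_of_nonneg (Finset.subset_univ _)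
      fun _ _ _ => ENNReal.toReal_nonneg
  have h3 : p * ∑ y ∈ Finset.univ.erase x, (μ y).toReal ≤ u / 8 := by nlinarith
  have h4 : (-1 / u) * (p * ∑ y ∈ Finset.univ.erase x, (μ y).toReal) ≥ -1 / 8 := by
    have : (1 / u) * (p * ∑ y ∈ Finset.univ.erase x, (μ y).toReal) ≤ (1 / u) * (u / 8) :=
      mul_le_mul_of_nonneg_left h3 (by positivity)
    have e : (1 / u) * (u / 8) = 1 / 8 := by field_simp
    rw [neg_div, neg_mul]
    linarith
  linarith

/-- Dense random sets dominate a witness. -/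
lemma hitProb_le {μ τ : PMF Ω} {O : ι → Set Ω → PMF Ω} {i : ι} (h : IsCondOracle μ (O i)) {x : Ω}
    {δ γ : ℝ} (hγ : 0 < γ)
    (hw : IsWitness (fun y => (μ y).toReal) (fun y => (τ y).toReal) δ γ x)
    (hx : 0 < (μ x).toReal) {m : ℕ} (hm : 400 * (μ x).toReal / γ ≤ (1 / 2 : ℝ) ^ m) :
    hitProb O i x m ≤ 1 / 5 := by
  rw [hitProb_eq h hx]
  have hle := hw.le
  have hq := hw.quarter_le
  set w : Ω → ℝ := (fun y => (μ y).toReal) + fun y => (τ y).toReal with hwdef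
  rw [erase_eq_lighter_union_heavier w x]
  set u := (μ x).toReal with hu
  set p := (1 / 2 : ℝ) ^ m
  set L := lighter w Finset.univ x with hL
  have hp0 : 0 ≤ p := by positivity
  have hp1 : p ≤ 1 := pow_le_one₀ (by norm_num) (by norm_num)
  have hnn : ∀ A : Finset Ω, 0 ≤ ∑ y ∈ A, (μ y).toReal :=
    fun A => Finset.sum_nonneg fun _ _ => ENNReal.toReal_nonneg
  refine (binomExp_union_le hp0 hp1 _ _ fun A z => ?_).trans ?_
  · refine div_le_div_of_nonneg_left hx.le (by linarith [hnn A]) ?_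
    have := Finset.sum_le_sum_of_subset_of_nonneg (Finset.subset_insert z A)
      (f := fun y => (μ y).toReal) fun _ _ _ => ENNReal.toReal_nonneg
    linarith
  set M := ∑ y ∈ L, (μ y).toReal with hM
  rw [div_le_iff₀ hγ] at hm
  have hM8 : γ / 8 ≤ M := by
    have : 400 * u ≤ γ := by nlinarith
    linarith
  have hmean : 50 * u ≤ p * M := by nlinarith
  set E := p * M with hE
  have hE0 : 0 < E := by linarith
  -- Chebyshev's inequality in the form of a pointwise bound
  have hpt : ∀ A ⊆ L, u / (u + ∑ y ∈ A, (μ y).toReal) ≤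
      2 * u / E + (4 / E ^ 2) * (∑ y ∈ A, (μ y).toReal - E) ^ 2 := by
    intro A _
    set W := ∑ y ∈ A, (μ y).toReal
    have hW : 0 ≤ W := hnn A
    rcases le_total (E / 2) W with hc | hc
    · have h1 : u / (u + W) ≤ u / (E / 2) :=
        div_le_div_of_nonneg_left hx.le (by positivity) (by linarith)
      have h2 : u / (E / 2) = 2 * u / E := by field_simp
      have h3 : 0 ≤ (4 / E ^ 2) * (W - E) ^ 2 := by positivity
      linarith
    · have h1 : u / (u + W) ≤ 1 := (div_le_one (by positivity)).2 (by linarith)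
      have h2 : (E / 2) ^ 2 ≤ (W - E) ^ 2 := by nlinarith
      have h3 : (4 / E ^ 2) * (E / 2) ^ 2 = 1 := by field_simp; norm_num
      have h4 : (4 / E ^ 2) * (E / 2) ^ 2 ≤ (4 / E ^ 2) * (W - E) ^ 2 :=
        mul_le_mul_of_nonneg_left h2 (by positivity)
      have h5 : 0 ≤ 2 * u / E := by positivity
      linarith
  refine (binomExp_mono hp0 hp1 L hpt).trans ?_
  rw [binomExp_add, binomExp_const, binomExp_const_mul, binomExp_sum_sub_sq, ← hM, ← hE, sub_self]
  have hvar : p * (1 - p) * ∑ y ∈ L, (μ y).toReal ^ 2 ≤ 2 * u * E := by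
    have h1 : ∑ y ∈ L, (μ y).toReal ^ 2 ≤ 2 * u * M := by
      rw [hM, Finset.mul_sum]
      refine Finset.sum_le_sum fun y hy => ?_
      have h1 := (mem_lighter.1 hy).2.le
      simp only [hwdef, Pi.add_apply] at h1
      have h2 : 0 ≤ (τ y).toReal := ENNReal.toReal_nonneg
      have h3 : 0 ≤ (μ y).toReal := ENNReal.toReal_nonneg
      nlinarith
    have h2 : 0 ≤ ∑ y ∈ L, (μ y).toReal ^ 2 := Finset.sum_nonneg fun y _ => sq_nonneg _
    have h3 : p * (1 - p) ≤ p := by nlinarith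
    calc _ ≤ p * ∑ y ∈ L, (μ y).toReal ^ 2 := mul_le_mul_of_nonneg_right h3 h2
      _ ≤ p * (2 * u * M) := mul_le_mul_of_nonneg_left h1 hp0
      _ = _ := by rw [hE]; ring
  have h1 : (4 / E ^ 2) * (0 ^ 2 + p * (1 - p) * ∑ y ∈ L, (μ y).toReal ^ 2) ≤
      (4 / E ^ 2) * (2 * u * E) := by
    refine mul_le_mul_of_nonneg_left ?_ (by positivity)
    linarith
  have h2 : 2 * u / E + (4 / E ^ 2) * (2 * u * E) = 10 * u / E := by field_simp; norm_num
  have h3 : 10 * u / E ≤ 1 / 5 := by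
    rw [div_le_iff₀ hE0]
    linarith
  linarith

end HitProb

/-! ### Dyadic levels -/

section Levels

lemma le_add_sum_dyadic {r s : ℝ} (hs : 0 ≤ s) (hrs : r ≤ s) (m : ℕ) :
    r ≤ (1 / 2 : ℝ) ^ m * s + ∑ l ∈ Finset.range m,
      (if (1 / 2 : ℝ) ^ (l + 1) * s ≤ r then (1 / 2 : ℝ) ^ l * s else 0) := by
  induction m with
  | zero => simpa using hrs
  | succ m ih =>
    rw [Finset.sum_range_succ]
    split_ifs with h
    · have : 0 ≤ (1 / 2 : ℝ) ^ (m + 1) * s := by positivity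
      linarith
    · have : 0 ≤ ∑ l ∈ Finset.range m,
          (if (1 / 2 : ℝ) ^ (l + 1) * s ≤ r then (1 / 2 : ℝ) ^ l * s else 0) :=
        Finset.sum_nonneg fun l _ => by split_ifs <;> positivity
      linarith

variable {Ω : Type} [LinearOrder Ω]

lemma lowMass_comm (a b : Ω → ℝ) (s : Finset Ω) (x : Ω) : lowMass b a s x = lowMass a b s x := by
  simp only [lowMass, add_comm]

lemma discrepancy_comm (a b : Ω → ℝ) (s : Finset Ω) (x : Ω) :
    discrepancy b a s x = discrepancy a b s x := by
  simp only [discrepancy, add_comm b a]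
  exact abs_sub_comm _ _

lemma balanced_comm (a b : Ω → ℝ) (s : Finset Ω) (x : Ω) : Balanced b a s x ↔ Balanced a b s x := by
  simp only [Balanced, add_comm b a, lowMass_comm]
  rw [abs_sub_comm]

variable [Fintype Ω]

lemma discrepancy_div_lowMass_le (a b : Ω → ℝ) (ha : ∀ y, 0 ≤ a y) (hb : ∀ y, 0 ≤ b y) (x : Ω) :
    discrepancy a b Finset.univ x / lowMass a b Finset.univ x ≤ a x + b x := by
  have hM : 0 ≤ ∑ y ∈ lighter (a + b) Finset.univ x, a y := Finset.sum_nonneg fun y _ => ha y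
  have hT : 0 ≤ ∑ y ∈ lighter (a + b) Finset.univ x, b y := Finset.sum_nonneg fun y _ => hb y
  have hax := ha x
  have hbx := hb x
  simp only [discrepancy, lowMass, Finset.sum_add_distrib]
  generalize ∑ y ∈ lighter (a + b) Finset.univ x, a y = M at *
  generalize ∑ y ∈ lighter (a + b) Finset.univ x, b y = T at *
  refine div_le_of_le_mul₀ (by positivity) (by positivity) (abs_le.2 ⟨?_, ?_⟩) <;>
    nlinarith [mul_nonneg hax hM, mul_nonneg hax hT, mul_nonneg hbx hM, mul_nonneg hbx hT]

open Classical in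
/-- If `a` and `b` are at distance more than `ε`, then for one of `m` dyadic scales `δ` of
deviation the corresponding witnesses have mass of order `ε / (δ m)`. -/
lemma exists_level (a b : Ω → ℝ) (ha : ∀ y, 0 ≤ a y) (hb : ∀ y, 0 ≤ b y)
    (ha1 : ∑ y, a y = 1) (hb1 : ∑ y, b y = 1) {ε e : ℝ} {m : ℕ} (he : 0 ≤ e)
    (hdist : ε < 1 / 2 * ∑ x, |a x - b x|) (hm : 16 * (1 / 2 : ℝ) ^ m ≤ ε)
    (hem : 80 * e * m ≤ ε) :
    ∃ l < m, e * 2 ^ (l + 1) ≤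
        (∑ x with IsWitness a b ((1 / 2) ^ (l + 1)) (e * 2 ^ (l + 1)) x, a x) ∨
      e * 2 ^ (l + 1) ≤
        (∑ x with IsWitness b a ((1 / 2) ^ (l + 1)) (e * 2 ^ (l + 1)) x, b x) := by
  by_contra hcon
  push Not at hcon
  have hstruct := sum_abs_sub_le a b ha hb Finset.univ
  rw [ha1, hb1, sub_self, abs_zero, mul_zero, zero_add] at hstruct
  set r : Ω → ℝ := fun x => discrepancy a b Finset.univ x / lowMass a b Finset.univ x with hr
  have hs0 : ∀ x, 0 ≤ a x + b x := fun x => add_nonneg (ha x) (hb x)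
  have hV0 : ∀ x, 0 ≤ lowMass a b Finset.univ x := fun x =>
    add_nonneg (Finset.sum_nonneg fun z _ => hs0 z) (hs0 x)
  -- the mass at each scale
  have hlevel : ∀ l < m, ∑ x with Balanced a b Finset.univ x,
      (if (1 / 2 : ℝ) ^ (l + 1) * (a x + b x) ≤ r x then (1 / 2 : ℝ) ^ l * (a x + b x) else 0) ≤
        10 * e := by
    intro l hl
    obtain ⟨h1, h2⟩ := hcon l hl
    set δ : ℝ := (1 / 2) ^ (l + 1) with hδ
    set γ : ℝ := e * 2 ^ (l + 1) with hγ
    have hγ0 : 0 ≤ γ := by positivity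
    have hlow := sum_lowMass_lt_le a b ha hb Finset.univ hγ0
    have hpt : ∀ x, (if Balanced a b Finset.univ x then
        (if δ * (a x + b x) ≤ r x then (1 / 2 : ℝ) ^ l * (a x + b x) else 0) else 0) ≤
        (1 / 2 : ℝ) ^ l * ((if lowMass a b Finset.univ x < γ then a x + b x else 0) +
          (2 * (if IsWitness a b δ γ x then a x else 0) +
           2 * (if IsWitness b a δ γ x then b x else 0))) := by
      intro x
      have hax := ha x
      have hbx := hb x
      have hrhs : 0 ≤ (1 / 2 : ℝ) ^ l * ((if lowMass a b Finset.univ x < γ then a x + b x else 0) +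
          (2 * (if IsWitness a b δ γ x then a x else 0) +
           2 * (if IsWitness b a δ γ x then b x else 0))) := by
        refine mul_nonneg (by positivity) (add_nonneg ?_ (add_nonneg ?_ ?_)) <;>
          split_ifs <;> positivity
      by_cases hbal : Balanced a b Finset.univ x
      swap
      · rwa [if_neg hbal]
      by_cases hge : δ * (a x + b x) ≤ r x
      swap
      · rwa [if_pos hbal, if_neg hge]
      · rw [if_pos hbal, if_pos hge]
        refine mul_le_mul_of_nonneg_left ?_ (by positivity)
        by_cases hlow : lowMass a b Finset.univ x < γ
        · rw [if_pos hlow]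
          have : 0 ≤ 2 * (if IsWitness a b δ γ x then a x else 0) +
              2 * (if IsWitness b a δ γ x then b x else 0) := by
            refine add_nonneg ?_ ?_ <;> split_ifs <;> positivity
          linarith
        · have hdisc : δ * (lowMass a b Finset.univ x * (a x + b x)) ≤
              discrepancy a b Finset.univ x := by
            rcases (hV0 x).eq_or_lt with h0 | h0
            · rw [← h0, zero_mul, mul_zero]; exact abs_nonneg _
            · rw [hr] at hge
              have := (le_div_iff₀ h0).1 hge
              linarith
          rw [if_neg hlow]
          rw [not_lt] at hlow
          rcases le_total (b x) (a x) with hle | hle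
          · rw [if_pos (⟨hle, hlow, hbal, hdisc⟩ : IsWitness a b δ γ x)]
            split_ifs <;> linarith
          · rw [if_pos (⟨hle, by rwa [lowMass_comm], by rwa [balanced_comm], by
              rwa [lowMass_comm, discrepancy_comm, add_comm (b x)]⟩ : IsWitness b a δ γ x)]
            split_ifs <;> linarith
    rw [Finset.sum_filter]
    refine (Finset.sum_le_sum fun x _ => hpt x).trans ?_
    rw [← Finset.mul_sum, Finset.sum_add_distrib, Finset.sum_add_distrib, ← Finset.mul_sum,
      ← Finset.mul_sum, ← Finset.sum_filter, ← Finset.sum_filter, ← Finset.sum_filter]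
    have hpow : (1 / 2 : ℝ) ^ l * (5 * γ) = 10 * e := by
      have : (1 / 2 : ℝ) ^ l * 2 ^ l = 1 := by rw [← mul_pow]; norm_num
      rw [hγ, pow_succ]
      linear_combination (10 * e) * this
    rw [← hpow]
    exact mul_le_mul_of_nonneg_left (by linarith) (by positivity)
  have hsum : ∑ x with Balanced a b Finset.univ x, r x ≤ 2 * (1 / 2 : ℝ) ^ m + m * (10 * e) := by
    calc ∑ x with Balanced a b Finset.univ x, r x
        ≤ ∑ x with Balanced a b Finset.univ x, ((1 / 2 : ℝ) ^ m * (a x + b x) +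
          ∑ l ∈ Finset.range m, (if (1 / 2 : ℝ) ^ (l + 1) * (a x + b x) ≤ r x then
            (1 / 2 : ℝ) ^ l * (a x + b x) else 0)) :=
          Finset.sum_le_sum fun x _ =>
            le_add_sum_dyadic (hs0 x) (discrepancy_div_lowMass_le a b ha hb x) m
      _ ≤ _ := by
          rw [Finset.sum_add_distrib, ← Finset.mul_sum, Finset.sum_comm]
          refine add_le_add ?_ ?_
          · rw [mul_comm]
            refine mul_le_mul_of_nonneg_right ?_ (by positivity)
            calc _ ≤ ∑ x, (a x + b x) := Finset.sum_le_sum_of_subset_of_nonneg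
                  (Finset.filter_subset _ _) fun x _ _ => hs0 x
              _ = 2 := by rw [Finset.sum_add_distrib, ha1, hb1]; norm_num
          · refine (Finset.sum_le_sum fun l hl => hlevel l (Finset.mem_range.1 hl)).trans ?_
            rw [Finset.sum_const, Finset.card_range, nsmul_eq_mul]
  linarith

end Levels

/-! ### The tester -/

section Tester

variable {ι Ω : Type} [Fintype Ω] [LinearOrder Ω]

/-- Compare the oracles `i` and `j` at `x` on a random set whose density is `2⁻ᵐ` times a random
power of two between `2⁻ᴵ` and `1`. -/
noncomputable def probe (i j : ι) (x : Ω) (I n : ℕ) (t : ℝ) (m : ℕ) : CondAlg ι Ω Bool :=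
  .coin (PMF.uniformOfFintype (Fin (I + 1))) fun s =>
    .coin (randSubset (m + s) (Finset.univ.erase x)) fun A =>
      compareLoop i j x (insert x A : Finset Ω) (n * t / 2) n 0

/-- Sample `x` from oracle `i`, find the density of the random sets that balance it, and probe
`R` random sets of about this density. -/
noncomputable def trial (i j : ι) (J T I R n : ℕ) (t : ℝ) : CondAlg ι Ω Bool :=
  .query i Set.univ fun x => randomSearch i x J T fun m => (probe i j x I n t m).repeated R

lemma maxQueries_trial (i j : ι) (J T I R n : ℕ) (t : ℝ) :
    (trial i j J T I R n t : CondAlg ι Ω Bool).maxQueries ≤ (R * (2 * n) + T + 1 : ℕ) :=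
  CondAlg.maxQueries_query _ _ _ fun _ => maxQueries_randomSearch _ _ _ _ _ fun _ =>
    CondAlg.maxQueries_repeated (CondAlg.maxQueries_coin _ _ fun _ =>
      CondAlg.maxQueries_coin _ _ fun _ => maxQueries_compareLoop _ _ _ _ _ _ _) _

lemma one_sub_mul_le_pow {y : ℝ} (h0 : 0 ≤ y) (n : ℕ) : 1 - n * (1 - y) ≤ y ^ n := by
  have := one_add_mul_le_pow (a := y - 1) (by linarith) n
  rw [add_sub_cancel] at this
  linarith

/-- If both oracles belong to the same distribution, all comparisons are fair. -/
lemma le_acc_trial {μ : PMF Ω} {O : ι → Set Ω → PMF Ω} {i j : ι} (hi : IsCondOracle μ (O i))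
    (hj : IsCondOracle μ (O j)) (J T I R n : ℕ) {t : ℝ} (ht : 0 ≤ t) :
    1 - R * (2 * Real.exp (-(n * t ^ 2 / 8))) ≤ (trial i j J T I R n t).acc O := by
  rw [trial, CondAlg.acc_query, hi.apply_univ]
  refine le_sum_toReal_mul _ _ fun x hx => ?_
  have hprobe : ∀ m, 1 - 2 * Real.exp (-(n * t ^ 2 / 8)) ≤ (probe i j x I n t m).acc O := by
    intro m
    rw [probe, CondAlg.acc_coin]
    refine le_sum_toReal_mul _ _ fun s _ => ?_
    rw [CondAlg.acc_coin]
    refine le_sum_toReal_mul _ _ fun A _ => le_acc_compareLoop O i j x _ ?_ ht n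
    have hex : ∃ y ∈ ((insert x A : Finset Ω) : Set Ω), y ∈ μ.support := ⟨x, by simp, hx⟩
    rw [hi _ hex, hj _ hex]
  have hrep : ∀ m, 1 - R * (2 * Real.exp (-(n * t ^ 2 / 8))) ≤
      ((probe i j x I n t m).repeated R).acc O := by
    intro m
    rw [CondAlg.acc_repeated]
    refine le_trans ?_ (one_sub_mul_le_pow (CondAlg.acc_nonneg _ _) R)
    have := mul_le_mul_of_nonneg_left
      (show 1 - (probe i j x I n t m).acc O ≤ 2 * Real.exp (-(n * t ^ 2 / 8)) by
        linarith [hprobe m]) (Nat.cast_nonneg (α := ℝ) R)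
    linarith
  rw [randomSearch, CondAlg.acc_coin]
  refine le_sum_toReal_mul _ _ fun k _ => ?_
  generalize (k : ℕ) = k
  generalize (fun _ : ℕ => (1 : ℝ)) = w
  induction k generalizing w with
  | zero => exact hrep _
  | succ k ih =>
    rw [search, CondAlg.acc_coin]
    refine le_sum_toReal_mul _ _ fun A _ => ?_
    rw [CondAlg.acc_query]
    exact le_sum_toReal_mul _ _ fun y _ => ih _

lemma exists_half_pow_near {y : ℝ} (h0 : 0 < y) (h1 : y ≤ 1) :
    ∃ j : ℕ, y / 2 ≤ (1 / 2 : ℝ) ^ j ∧ (1 / 2 : ℝ) ^ j < y := by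
  obtain ⟨n, hn1, hn2⟩ := exists_nat_pow_near_of_lt_one h0 h1 (y := (1 / 2 : ℝ)) (by norm_num)
    (by norm_num)
  refine ⟨n + 1, ?_, hn1⟩
  rw [pow_succ]
  linarith

lemma lt_of_half_pow_lt {m n : ℕ} (h : (1 / 2 : ℝ) ^ n < (1 / 2 : ℝ) ^ m) : m < n :=
  (pow_lt_pow_iff_right_of_lt_one₀ (by norm_num) (by norm_num)).1 h

lemma pow_le_half {y : ℝ} {n : ℕ} (hy1 : y ≤ 1) (h : 1 ≤ n * y) : (1 - y) ^ n ≤ 1 / 2 := by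
  have h1 : (1 - y) ^ n ≤ Real.exp (-y) ^ n :=
    pow_le_pow_left₀ (by linarith) (Real.one_sub_le_exp_neg y) n
  rw [← Real.exp_nat_mul] at h1
  have h2 : Real.exp (n * -y) ≤ Real.exp (-1) := Real.exp_le_exp.2 (by linarith)
  have h3 : Real.exp (-1) ≤ 1 / 2 := by
    rw [Real.exp_neg, one_div]
    exact inv_anti₀ (by norm_num) (by linarith [Real.exp_one_gt_d9])
  linarith

open Classical in
/-- At a witness, a probe that starts from a suitable level rejects with probability of
order `δ² γ`. -/
lemma acc_probe_le {μ τ : PMF Ω} {O : ι → Set Ω → PMF Ω} {i j : ι} (hi : IsCondOracle μ (O i))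
    (hj : IsCondOracle τ (O j)) {x : Ω} {δ γ : ℝ} (hδ : 0 < δ) (hγ : 0 < γ)
    (hw : IsWitness (fun y => (μ y).toReal) (fun y => (τ y).toReal) δ γ x)
    (hx : 0 < (μ x).toReal) {I n m : ℕ} (hI : 12800 ≤ 2 ^ I * γ)
    (hn : 8 / (δ * γ / 32) ^ 2 ≤ n) (hm1 : (μ x).toReal / 8 < (1 / 2 : ℝ) ^ m)
    (hm2 : (1 / 2 : ℝ) ^ m < 400 * (μ x).toReal / γ) :
    (probe i j x I n (δ * γ / 32) m).acc O ≤ 1 - 1 / (I + 1) * (δ ^ 2 * γ / 256 * (1 / 2)) := by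
  have hle : (τ x).toReal ≤ (μ x).toReal := hw.le
  have hμ1 := toReal_apply_le_one μ x
  have hτ0 : 0 ≤ (τ x).toReal := ENNReal.toReal_nonneg
  set u := (μ x).toReal with hu
  set v := (τ x).toReal with hv
  obtain ⟨k, hk1, hk2⟩ := exists_half_pow_near (y := (u + v) / 16) (by positivity) (by linarith)
  have hmk : m < k := lt_of_half_pow_lt (by linarith)
  obtain ⟨s, rfl⟩ := Nat.exists_eq_add_of_lt hmk
  have hsI : s + 1 < I + 1 := by
    have h1 : (1 / 2 : ℝ) ^ (m + s + 1) = (1 / 2 : ℝ) ^ m * (1 / 2 : ℝ) ^ (s + 1) := by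
      rw [add_assoc, pow_add]
    rw [h1] at hk1
    have h2 : u / 32 < 400 * u / γ * (1 / 2 : ℝ) ^ (s + 1) := by
      have := mul_lt_mul_of_pos_right hm2 (show (0 : ℝ) < (1 / 2) ^ (s + 1) by positivity)
      linarith
    have h3 : γ < 12800 * (1 / 2 : ℝ) ^ (s + 1) := by
      have e : 400 * u / γ * (1 / 2 : ℝ) ^ (s + 1) =
          u / 32 * (12800 * (1 / 2 : ℝ) ^ (s + 1) / γ) := by
        field_simp; norm_num
      rw [e] at h2
      have h4 : 1 < 12800 * (1 / 2 : ℝ) ^ (s + 1) / γ := by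
        by_contra hc
        push Not at hc
        have := mul_le_mul_of_nonneg_left hc (show 0 ≤ u / 32 by positivity)
        linarith
      rwa [lt_div_iff₀ hγ, one_mul] at h4
    have h5 : (2 : ℝ) ^ (s + 1) < 2 ^ I := by
      have h6 : (2 : ℝ) ^ (s + 1) * (1 / 2 : ℝ) ^ (s + 1) = 1 := by rw [← mul_pow]; norm_num
      have h7 : (2 : ℝ) ^ (s + 1) * γ < 2 ^ (s + 1) * (12800 * (1 / 2 : ℝ) ^ (s + 1)) :=
        mul_lt_mul_of_pos_left h3 (by positivity)
      have h8 : (2 : ℝ) ^ (s + 1) * γ < 2 ^ I * γ := by nlinarith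
      exact lt_of_mul_lt_mul_right h8 hγ.le
    have := (pow_lt_pow_iff_right₀ (by norm_num : (1 : ℝ) < 2)).1 h5
    omega
  rw [probe, CondAlg.acc_coin]
  refine sum_toReal_mul_le _ _ (by positivity) {⟨s + 1, hsI⟩} ?_
    (fun _ => CondAlg.acc_le_one _ _) ?_
  · rw [Finset.sum_singleton, PMF.uniformOfFintype_apply, Fintype.card_fin, ENNReal.toReal_inv,
      ENNReal.toReal_natCast]
    push_cast
    rw [one_div]
  intro s' hs'
  rw [Finset.mem_singleton] at hs'
  subst hs'
  rw [CondAlg.acc_coin]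
  have hp1 : (1 / 2 : ℝ) ^ (m + (s + 1)) ≤ 1 := pow_le_one₀ (by norm_num) (by norm_num)
  have hdist := binomExp_distinguishes (a := fun y => (μ y).toReal) (b := fun y => (τ y).toReal)
    (fun _ => ENNReal.toReal_nonneg) (fun _ => ENNReal.toReal_nonneg) (sum_toReal_eq_one μ)
    (sum_toReal_eq_one τ) hδ hγ.le hw hx (p := (1 / 2 : ℝ) ^ (m + (s + 1)))
    (by rw [← add_assoc]; linarith) (by rw [← add_assoc]; exact hk2.le) hp1
  refine sum_toReal_mul_le _ _ (by norm_num)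
    (Finset.univ.filter fun A => A ⊆ Finset.univ.erase x ∧
      Distinguishes (fun y => (μ y).toReal) (fun y => (τ y).toReal) (δ * γ / 32) x A) ?_
    (fun _ => CondAlg.acc_le_one _ _) ?_
  · have h := sum_randSubset_mul (m + (s + 1)) (Finset.univ.erase x)
      (fun A => if A ⊆ Finset.univ.erase x ∧
        Distinguishes (fun y => (μ y).toReal) (fun y => (τ y).toReal) (δ * γ / 32) x A
        then (1 : ℝ) else 0)
    simp only [mul_ite, mul_one, mul_zero] at h
    rw [← Finset.sum_filter] at h
    rw [h]
    refine hdist.trans (binomExp_mono (by positivity) hp1 _ fun A hA => ?_)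
    simp [hA]
  · intro A hA
    obtain ⟨hAx, hpos, hd⟩ := (Finset.mem_filter.1 hA).2
    have h1 := sum_insert_toReal (μ := μ) hAx
    have h2 := sum_insert_toReal (μ := τ) hAx
    have hμA : 0 ≤ ∑ y ∈ A, (μ y).toReal := Finset.sum_nonneg fun _ _ => ENNReal.toReal_nonneg
    have hposμ : 0 < u + ∑ y ∈ A, (μ y).toReal := by positivity
    have := acc_compareLoop_le_half O i j x (insert x A : Finset Ω) (t := δ * γ / 32) (n := n)
      (by positivity) ?_ hn
    · norm_num
      exact_mod_cast this
    · rw [hi.toReal_apply (Finset.mem_insert_self x A) (by rwa [h1]),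
        hj.toReal_apply (Finset.mem_insert_self x A) (by rwa [h2]), h1, h2,
        div_sub_div _ _ hposμ.ne' hpos.ne', abs_div, abs_of_pos (mul_pos hposμ hpos),
        le_div_iff₀ (mul_pos hposμ hpos)]
      refine hd.trans (le_of_eq ?_)
      congr 1
      ring

open Classical in
/-- A trial rejects with probability of the order of the mass of the witnesses. -/
lemma acc_trial_le {μ τ : PMF Ω} {O : ι → Set Ω → PMF Ω} {i j : ι} (hi : IsCondOracle μ (O i))
    (hj : IsCondOracle τ (O j)) {δ γ : ℝ} (hδ : 0 < δ) (hδ1 : δ ≤ 1) (hγ : 0 < γ)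
    (hmass : γ ≤ ∑ x with IsWitness (fun y => (μ y).toReal) (fun y => (τ y).toReal) δ γ x,
      (μ x).toReal)
    {J T I R n : ℕ} (hJ : 4 * Fintype.card Ω * (1 / 2 : ℝ) ^ J < γ) (hT : 10 * Real.log J ≤ T)
    (hI : 12800 ≤ 2 ^ I * γ) (hR : 512 * (I + 1) ≤ R * (δ ^ 2 * γ))
    (hn : 8 / (δ * γ / 32) ^ 2 ≤ n) :
    (trial i j J T I R n (δ * γ / 32)).acc O ≤ 1 - γ * (1 / 25) := by
  have hγ1 : γ ≤ 1 := by
    refine hmass.trans ?_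
    rw [← sum_toReal_eq_one μ]
    exact Finset.sum_le_sum_of_subset_of_nonneg (Finset.filter_subset _ _)
      fun _ _ _ => ENNReal.toReal_nonneg
  rw [trial, CondAlg.acc_query, hi.apply_univ]
  refine sum_toReal_mul_le _ _ (by norm_num)
    ((Finset.univ.filter fun x =>
      IsWitness (fun y => (μ y).toReal) (fun y => (τ y).toReal) δ γ x).filter
        fun x => (μ x).toReal ≠ 0) ?_ (fun _ => CondAlg.acc_le_one _ _) ?_
  · rwa [Finset.sum_filter_ne_zero]
  intro x hx
  rw [Finset.mem_filter, Finset.mem_filter] at hx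
  obtain ⟨⟨_, hw⟩, hx0⟩ := hx
  have hx0 : 0 < (μ x).toReal := lt_of_le_of_ne ENNReal.toReal_nonneg hx0.symm
  have hle : (τ x).toReal ≤ (μ x).toReal := hw.le
  have hμ1 := toReal_apply_le_one μ x
  have hτ0 : 0 ≤ (τ x).toReal := ENNReal.toReal_nonneg
  have hV := hw.lowMass_ge.trans (lowMass_le_card_mul (fun y => (μ y).toReal)
    (fun y => (τ y).toReal) (fun _ => ENNReal.toReal_nonneg) (fun _ => ENNReal.toReal_nonneg) x)
  obtain ⟨z, hz1, hz2⟩ := exists_half_pow_near hx0 hμ1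
  have hcard : (0 : ℝ) < Fintype.card Ω := by
    exact_mod_cast Fintype.card_pos_iff.2 ⟨x⟩
  have hzJ : z < J := by
    refine lt_of_half_pow_lt (lt_of_lt_of_le ?_ hz1)
    have : 4 * (Fintype.card Ω : ℝ) * (1 / 2 : ℝ) ^ J <
        4 * (Fintype.card Ω : ℝ) * ((μ x).toReal / 2) := by nlinarith
    exact lt_of_mul_lt_mul_left this (by positivity)
  set u := (μ x).toReal with hu
  have hyp : (randomSearch i x J T fun m => (probe i j x I n (δ * γ / 32) m).repeated R).acc O
      ≤ 24 / 25 := by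
    refine acc_randomSearch_le O i x hzJ
      {m | u / 8 < (1 / 2 : ℝ) ^ m ∧ (1 / 2 : ℝ) ^ m < 400 * u / γ} ?_ _ ?_ hT
    · intro m hm
      rw [Set.mem_ofPred_eq, not_and_or, not_lt, not_lt] at hm
      rcases hm with hm | hm
      · exact Or.inl ⟨lt_of_half_pow_lt (by linarith), hitProb_ge hi hx0 hm⟩
      · refine Or.inr ⟨lt_of_half_pow_lt (lt_of_lt_of_le hz2 (le_trans ?_ hm)),
          hitProb_le hi hγ hw hx0 hm⟩
        rw [le_div_iff₀ hγ]
        nlinarith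
    · rintro m ⟨hm1, hm2⟩
      rw [CondAlg.acc_repeated]
      have hp := acc_probe_le hi hj hδ hγ hw hx0 hI hn hm1 hm2
      set y : ℝ := 1 / (I + 1) * (δ ^ 2 * γ / 256 * (1 / 2)) with hy
      refine (pow_le_pow_left₀ (CondAlg.acc_nonneg _ _) hp R).trans (pow_le_half ?_ ?_)
      · have h1 : (1 : ℝ) / (I + 1) ≤ 1 := by
          rw [div_le_one (by positivity)]
          linarith [Nat.cast_nonneg (α := ℝ) I]
        have h2 : δ ^ 2 ≤ 1 := pow_le_one₀ hδ.le hδ1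
        have h3 : δ ^ 2 * γ ≤ 1 := by nlinarith
        have h4 : δ ^ 2 * γ / 256 * (1 / 2) ≤ 1 := by linarith
        have h5 : 0 ≤ δ ^ 2 * γ / 256 * (1 / 2) := by positivity
        exact mul_le_one₀ h1 h5 h4
      · have : R * y = R * (δ ^ 2 * γ) / (512 * (I + 1)) := by rw [hy]; field_simp; ring
        rw [this, le_div_iff₀ (by positivity), one_mul]
        exact hR
  linarith

end Tester

section FullTester

variable {Ω : Type} [Fintype Ω] [LinearOrder Ω]

/-- The tester: for each of `m` dyadic levels of deviation, run trials with samples from each of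
the two distributions. The numbers of trials `R₁` and of probes per trial `R₂` depend on the
level. -/
noncomputable def tester (Ω : Type) [Fintype Ω] [LinearOrder Ω] (m J T I n : ℕ) (t : ℝ)
    (R₁ R₂ : ℕ → ℕ) : CondAlg (Fin 2) Ω Bool :=
  CondAlg.allOf (fun l => CondAlg.both ((trial 1 0 J T I (R₂ l) n t).repeated (R₁ l))
    ((trial 0 1 J T I (R₂ l) n t).repeated (R₁ l))) m

lemma maxQueries_tester (m J T I n : ℕ) (t : ℝ) (R₁ R₂ : ℕ → ℕ) :
    (tester Ω m J T I n t R₁ R₂).maxQueries ≤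
      (∑ l ∈ Finset.range m, (R₁ l * (R₂ l * (2 * n) + T + 1) +
        R₁ l * (R₂ l * (2 * n) + T + 1)) : ℕ) :=
  CondAlg.maxQueries_allOf (fun _ => CondAlg.maxQueries_both
    (CondAlg.maxQueries_repeated (maxQueries_trial _ _ _ _ _ _ _ _) _)
    (CondAlg.maxQueries_repeated (maxQueries_trial _ _ _ _ _ _ _ _) _)) m

lemma one_sub_sum_le_prod {s : Finset ℕ} {f : ℕ → ℝ} (h0 : ∀ i, 0 ≤ f i) (h1 : ∀ i, f i ≤ 1) :
    1 - ∑ i ∈ s, (1 - f i) ≤ ∏ i ∈ s, f i := by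
  induction s using Finset.induction_on with
  | empty => simp
  | insert x s hx ih =>
    rw [Finset.sum_insert hx, Finset.prod_insert hx]
    have hp : ∏ i ∈ s, f i ≤ 1 := Finset.prod_le_one (fun i _ => h0 i) fun i _ => h1 i
    nlinarith [mul_nonneg (sub_nonneg.2 (h1 x)) (sub_nonneg.2 hp)]

/-- Completeness, by a union bound over all comparisons. -/
lemma le_acc_tester {μ : PMF Ω} {O : Fin 2 → Set Ω → PMF Ω} (h0 : IsCondOracle μ (O 0))
    (h1 : IsCondOracle μ (O 1)) (m J T I n : ℕ) {t : ℝ} (ht : 0 ≤ t) (R₁ R₂ : ℕ → ℕ) :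
    1 - (∑ l ∈ Finset.range m, 2 * ((R₁ l : ℝ) * R₂ l)) * (2 * Real.exp (-(n * t ^ 2 / 8))) ≤
      (tester Ω m J T I n t R₁ R₂).acc O := by
  rw [tester, CondAlg.acc_allOf]
  refine le_trans ?_ (one_sub_sum_le_prod (fun _ => CondAlg.acc_nonneg _ _)
    fun _ => CondAlg.acc_le_one _ _)
  rw [Finset.sum_mul]
  refine sub_le_sub_left (Finset.sum_le_sum fun l _ => ?_) 1
  have key : ∀ i j : Fin 2, IsCondOracle μ (O i) → IsCondOracle μ (O j) →
      1 - (R₁ l : ℝ) * R₂ l * (2 * Real.exp (-(n * t ^ 2 / 8))) ≤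
        ((trial i j J T I (R₂ l) n t).repeated (R₁ l)).acc O := by
    intro i j hi hj
    rw [CondAlg.acc_repeated]
    refine le_trans ?_ (one_sub_mul_le_pow (CondAlg.acc_nonneg _ _) _)
    have := mul_le_mul_of_nonneg_left
      (sub_le_comm.1 (le_acc_trial hi hj J T I (R₂ l) n ht)) (Nat.cast_nonneg (α := ℝ) (R₁ l))
    linarith
  rw [CondAlg.acc_both]
  have k1 := key 0 1 h0 h1
  have k2 := key 1 0 h1 h0
  have a1 := CondAlg.acc_le_one O ((trial 0 1 J T I (R₂ l) n t).repeated (R₁ l))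
  have a2 := CondAlg.acc_le_one O ((trial 1 0 J T I (R₂ l) n t).repeated (R₁ l))
  nlinarith [mul_nonneg (sub_nonneg.2 a1) (sub_nonneg.2 a2)]

lemma pow_le_third {y z : ℝ} {n : ℕ} (hz0 : 0 ≤ z) (hz : z ≤ 1 - y) (h : 2 ≤ n * y) :
    z ^ n ≤ 1 / 3 := by
  have h1 : z ^ n ≤ Real.exp (-y) ^ n :=
    pow_le_pow_left₀ hz0 (hz.trans (Real.one_sub_le_exp_neg y)) n
  rw [← Real.exp_nat_mul] at h1
  have h2 : Real.exp (n * -y) ≤ Real.exp (-2) := Real.exp_le_exp.2 (by linarith)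
  have h3 : Real.exp (-2) ≤ 1 / 3 := by
    rw [Real.exp_neg, one_div]
    refine inv_anti₀ (by norm_num) ?_
    have : Real.exp 2 = Real.exp 1 * Real.exp 1 := by rw [← Real.exp_add]; norm_num
    rw [this]
    nlinarith [Real.exp_one_gt_d9]
  linarith

open Classical in
/-- Soundness: the trials of one level and one of the two roles already reject. -/
lemma acc_tester_le {μ τ : PMF Ω} {O : Fin 2 → Set Ω → PMF Ω} (h0 : IsCondOracle μ (O 0))
    (h1 : IsCondOracle τ (O 1)) {ε e : ℝ} {m J T I n : ℕ} {R₁ R₂ : ℕ → ℕ} (he : 0 < e)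
    (hdist : ε < dTV μ τ) (hm : 16 * (1 / 2 : ℝ) ^ m ≤ ε) (hem : 80 * e * m ≤ ε)
    (hJ : 4 * Fintype.card Ω * (1 / 2 : ℝ) ^ J < e) (hT : 10 * Real.log J ≤ T)
    (hI : 12800 ≤ 2 ^ I * e) (hn : 8 / (e / 32) ^ 2 ≤ n)
    (hR₁ : ∀ l < m, 50 ≤ R₁ l * (e * 2 ^ (l + 1)))
    (hR₂ : ∀ l < m, 512 * (I + 1) ≤ R₂ l * (((1 / 2 : ℝ) ^ (l + 1)) ^ 2 * (e * 2 ^ (l + 1)))) :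
    (tester Ω m J T I n (e / 32) R₁ R₂).acc O ≤ 1 / 3 := by
  have hlev := exists_level (fun x => (μ x).toReal) (fun x => (τ x).toReal)
    (fun _ => ENNReal.toReal_nonneg) (fun _ => ENNReal.toReal_nonneg) (sum_toReal_eq_one μ)
    (sum_toReal_eq_one τ) he.le hdist hm hem
  obtain ⟨l, hl, hlev⟩ := hlev
  have hδγ : (1 / 2 : ℝ) ^ (l + 1) * (e * 2 ^ (l + 1)) = e := by
    have : (1 / 2 : ℝ) ^ (l + 1) * 2 ^ (l + 1) = 1 := by rw [← mul_pow]; norm_num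
    linear_combination e * this
  have heγ : e ≤ e * 2 ^ (l + 1) := le_mul_of_one_le_right he.le (one_le_pow₀ (by norm_num))
  have key : ∀ (i j : Fin 2) (μ τ : PMF Ω), IsCondOracle μ (O i) → IsCondOracle τ (O j) →
      e * 2 ^ (l + 1) ≤ (∑ x with IsWitness (fun y => (μ y).toReal) (fun y => (τ y).toReal)
        ((1 / 2) ^ (l + 1)) (e * 2 ^ (l + 1)) x, (μ x).toReal) →
      ((trial i j J T I (R₂ l) n (e / 32)).repeated (R₁ l)).acc O ≤ 1 / 3 := by
    intro i j μ τ hi hj hmass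
    have h := acc_trial_le hi hj (by positivity) (pow_le_one₀ (by norm_num) (by norm_num))
      (by positivity) hmass (hJ.trans_le heγ) hT
      (hI.trans (mul_le_mul_of_nonneg_left heγ (by positivity))) (hR₂ l hl) (n := n)
      (by rwa [hδγ])
    rw [hδγ] at h
    rw [CondAlg.acc_repeated]
    refine pow_le_third (CondAlg.acc_nonneg _ _) h ?_
    linarith [hR₁ l hl]
  rw [tester, CondAlg.acc_allOf, ← Finset.mul_prod_erase _ _ (Finset.mem_range.2 hl)]
  refine (mul_le_of_le_one_right (CondAlg.acc_nonneg _ _)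
    (Finset.prod_le_one (fun _ _ => CondAlg.acc_nonneg _ _)
      fun _ _ => CondAlg.acc_le_one _ _)).trans ?_
  rw [CondAlg.acc_both]
  rcases hlev with h | h
  · exact (mul_le_of_le_one_right (CondAlg.acc_nonneg _ _) (CondAlg.acc_le_one _ _)).trans
      (key 0 1 μ τ h0 h1 h)
  · exact (mul_le_of_le_one_left (CondAlg.acc_nonneg _ _) (CondAlg.acc_le_one _ _)).trans
      (key 1 0 τ μ h1 h0 h)

end FullTester

/-! ### Parameters -/

section Parameters

lemma exists_pow_two_near {ε : ℝ} (h0 : 0 < ε) (h1 : ε < 1) :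
    ∃ m : ℕ, 5 ≤ m ∧ 16 / ε ≤ 2 ^ m ∧ (2 : ℝ) ^ m ≤ 32 / ε := by
  have h16 : 16 ≤ 16 / ε := by rw [le_div_iff₀ h0]; linarith
  obtain ⟨n, hn1, hn2⟩ := exists_nat_pow_near (x := 16 / ε) (y := (2 : ℝ)) (by linarith)
    (by norm_num)
  refine ⟨n + 1, ?_, hn2.le, ?_⟩
  · have : (2 : ℝ) ^ 4 < 2 ^ (n + 1) := by linarith
    have := (pow_lt_pow_iff_right₀ (by norm_num : (1 : ℝ) < 2)).1 this
    omega
  · rw [pow_succ]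
    have : 32 / ε = 16 / ε * 2 := by ring
    linarith

lemma le_six_mul_one_add_posLog {ε : ℝ} (h0 : 0 < ε) {m : ℕ} (hm : (2 : ℝ) ^ m ≤ 32 / ε) :
    (m : ℝ) ≤ 6 * (1 + Real.posLog (1 / ε)) := by
  have h1 := Real.log_le_log (by positivity) hm
  have h32 : Real.log 32 = 5 * Real.log 2 := by
    rw [show (32 : ℝ) = 2 ^ 5 by norm_num, Real.log_pow]; norm_num
  rw [Real.log_pow, div_eq_mul_one_div, Real.log_mul (by norm_num) (by positivity), h32] at h1
  have h2 : Real.log (1 / ε) ≤ Real.posLog (1 / ε) := le_max_right _ _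
  have h3 : 0 ≤ Real.posLog (1 / ε) := Real.posLog_nonneg
  have h4 := Real.log_two_gt_d9
  have h5 : (m : ℝ) * Real.log 2 ≤ (5 + 2 * Real.posLog (1 / ε)) * Real.log 2 := by nlinarith
  have h6 := le_of_mul_le_mul_right h5 (by linarith)
  linarith

/-- The number of levels of density is logarithmic in `N`, so that, up to terms in `m`, its
logarithm is of order `log⁺ (log N)`. -/
lemma log_levels_le (N : ℕ) {m : ℕ} (hm : 5 ≤ m) :
    Real.log ((Nat.log 2 N + 2 * m + 6 : ℕ) : ℝ) ≤ Real.posLog (Real.log N) + 2 * m + 7 := by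
  have h1 : Real.log ((Nat.log 2 N + 2 * m + 6 : ℕ) : ℝ) ≤
      Real.posLog ((Nat.log 2 N : ℝ) + (2 * m + 6)) := by
    push_cast
    rw [add_assoc]
    exact le_max_right _ _
  have h2 := Real.posLog_add (x := (Nat.log 2 N : ℝ)) (y := 2 * m + 6)
  have hl := Real.log_two_lt_d9
  have hl' := Real.log_two_gt_d9
  have h3 : Real.posLog (Nat.log 2 N : ℝ) ≤ 1 + Real.posLog (Real.log N) := by
    have hlog : (Nat.log 2 N : ℝ) ≤ 2 * Real.log N := by
      rcases Nat.eq_zero_or_pos N with rfl | hN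
      · simp
      · have h := Nat.pow_log_le_self 2 hN.ne'
        have h' : (2 : ℝ) ^ Nat.log 2 N ≤ N := by exact_mod_cast h
        have h'' := Real.log_le_log (by positivity) h'
        rw [Real.log_pow] at h''
        nlinarith [Nat.cast_nonneg (α := ℝ) (Nat.log 2 N)]
    have hp := Real.posLog_le_posLog (Nat.cast_nonneg _) hlog
    have hmul := Real.posLog_mul (x := 2) (y := Real.log N)
    have h2' : Real.posLog 2 = Real.log 2 := Real.posLog_eq_log (by norm_num)
    linarith
  have h4 : Real.posLog ((2 * m + 6 : ℝ)) ≤ 2 * m + 5 := by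
    have hm0 : (0 : ℝ) ≤ m := Nat.cast_nonneg m
    rw [Real.posLog_eq_log (by rw [abs_of_nonneg (by positivity)]; linarith)]
    have := Real.log_le_sub_one_of_pos (show (0 : ℝ) < 2 * m + 6 by positivity)
    linarith
  linarith

/-- The expected number of wrong comparisons between equal probabilities is at most `1 / 3`. -/
lemma comparisons_mul_exp_le {ε e : ℝ} (hε : 0 < ε) {m : ℕ} (hm5 : 5 ≤ m)
    (hm : 16 / ε ≤ 2 ^ m) (he : e = ε / (80 * m)) :
    366282 * (m : ℝ) ^ 2 / e ^ 2 * (2 * Real.exp (-(12 * m))) ≤ 1 / 3 := by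
  have hm0 : (0 : ℝ) < m := by exact_mod_cast (by omega : 0 < m)
  have hexp : (2 : ℝ) ^ (12 * m) ≤ Real.exp (12 * m) := by
    have h1 : Real.exp (12 * m) = Real.exp 1 ^ (12 * m) := by
      rw [← Real.exp_nat_mul]; push_cast; ring_nf
    rw [h1]
    exact pow_le_pow_left₀ (by norm_num) (by linarith [Real.exp_one_gt_d9]) _
  have hinv : 1 / ε ≤ 2 ^ m / 16 := by
    rw [le_div_iff₀ (by norm_num)]
    calc 1 / ε * 16 = 16 / ε := by ring
      _ ≤ _ := hm
  have hmp : (m : ℝ) ≤ 2 ^ m := by exact_mod_cast Nat.lt_two_pow_self.le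
  set P : ℝ := 2 ^ m with hP
  have hP0 : 0 < P := by positivity
  have h1 : 366282 * (m : ℝ) ^ 2 / e ^ 2 = 366282 * 6400 * (m : ℝ) ^ 4 * (1 / ε) ^ 2 := by
    rw [he]; field_simp; norm_num
  have h2 : (m : ℝ) ^ 4 * (1 / ε) ^ 2 ≤ P ^ 4 * (P / 16) ^ 2 :=
    mul_le_mul (pow_le_pow_left₀ hm0.le hmp 4) (pow_le_pow_left₀ (by positivity) hinv 2)
      (by positivity) (by positivity)
  have h3 : 2 ^ 26 * P ^ 6 ≤ (2 : ℝ) ^ (12 * m) := by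
    rw [hP, ← pow_mul, ← pow_add]
    exact pow_le_pow_right₀ (by norm_num) (by omega)
  rw [Real.exp_neg, ← mul_assoc, mul_inv_le_iff₀ (Real.exp_pos _), h1]
  have h4 : 0 ≤ P ^ 6 := by positivity
  linarith

/-- The parameters for which the tester is correct and makes the claimed number of queries. -/
lemma exists_parameters (N : ℕ) {ε : ℝ} (h0 : 0 < ε) (h1 : ε < 1) :
    ∃ (m J T I n : ℕ) (e : ℝ) (R₁ R₂ : ℕ → ℕ), 0 < e ∧ 16 * (1 / 2 : ℝ) ^ m ≤ ε ∧
      80 * e * m ≤ ε ∧ 4 * N * (1 / 2 : ℝ) ^ J < e ∧ 10 * Real.log J ≤ T ∧ 12800 ≤ 2 ^ I * e ∧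
      8 / (e / 32) ^ 2 ≤ n ∧
      (∀ l < m, 50 ≤ R₁ l * (e * 2 ^ (l + 1))) ∧
      (∀ l < m, 512 * (I + 1) ≤ R₂ l * (((1 / 2 : ℝ) ^ (l + 1)) ^ 2 * (e * 2 ^ (l + 1)))) ∧
      (∑ l ∈ Finset.range m, 2 * ((R₁ l : ℝ) * R₂ l)) *
        (2 * Real.exp (-(n * (e / 32) ^ 2 / 8))) ≤ 1 / 3 ∧
      ((∑ l ∈ Finset.range m, (R₁ l * (R₂ l * (2 * n) + T + 1) +
        R₁ l * (R₂ l * (2 * n) + T + 1)) : ℕ) : ℝ) ≤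
        10 ^ 25 * (Real.posLog (Real.log N) / ε + 1 / ε ^ 5) * (1 + Real.posLog (1 / ε)) ^ 7 := by
  obtain ⟨m, hm5, hm, hm'⟩ := exists_pow_two_near h0 h1
  have hmR : (5 : ℝ) ≤ m := by exact_mod_cast hm5
  have hm0 : (0 : ℝ) < m := by linarith
  set Λ := Real.posLog (Real.log N) with hΛ
  have hΛ0 : 0 ≤ Λ := Real.posLog_nonneg
  set e : ℝ := ε / (80 * m) with he
  have he0 : 0 < e := by positivity
  have he1 : e ≤ 1 := by
    rw [he, div_le_one (by positivity)]
    linarith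
  have hmul : 16 ≤ 2 ^ m * ε := by rwa [div_le_iff₀ h0] at hm
  have hmp : (m : ℝ) ≤ 2 ^ m := by exact_mod_cast Nat.lt_two_pow_self.le
  have hmhalf : (2 : ℝ) ^ m * (1 / 2) ^ m = 1 := by rw [← mul_pow]; norm_num
  have h4m : 16 * (m : ℝ) ≤ (2 ^ m) ^ 2 * ε := by nlinarith
  -- the scales
  have hδγ : ∀ l : ℕ, (1 / 2 : ℝ) ^ (l + 1) * (e * 2 ^ (l + 1)) = e := fun l => by
    have : (1 / 2 : ℝ) ^ (l + 1) * 2 ^ (l + 1) = 1 := by rw [← mul_pow]; norm_num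
    linear_combination e * this
  have hγe : ∀ l : ℕ, e ≤ e * 2 ^ (l + 1) := fun l =>
    le_mul_of_one_le_right he0.le (one_le_pow₀ (by norm_num))
  have hγ1 : ∀ l < m, e * 2 ^ (l + 1) ≤ 1 := fun l hl => by
    have h2 : (2 : ℝ) ^ (l + 1) ≤ 2 ^ m := pow_le_pow_right₀ (by norm_num) hl
    calc e * 2 ^ (l + 1) ≤ e * (32 / ε) := mul_le_mul_of_nonneg_left (h2.trans hm') he0.le
      _ = 32 / (80 * m) := by rw [he]; field_simp
      _ ≤ 1 := by rw [div_le_one (by positivity)]; linarith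
  set I := 2 * m + 20 with hI
  have hI7 : (I : ℝ) + 1 ≤ 7 * m := by rw [hI]; push_cast; linarith
  set T := ⌈10 * Real.log ((Nat.log 2 N + 2 * m + 6 : ℕ) : ℝ)⌉₊ with hT
  have hTle : (T : ℝ) + 1 ≤ 10 * Λ + 41 * m := by
    have hlog := log_levels_le N hm5
    have hc : (T : ℝ) < 10 * Real.log ((Nat.log 2 N + 2 * m + 6 : ℕ) : ℝ) + 1 := by
      refine Nat.ceil_lt_add_one (mul_nonneg (by norm_num) (Real.log_nonneg ?_))
      exact_mod_cast (by omega : 1 ≤ Nat.log 2 N + 2 * m + 6)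
    linarith
  set n := ⌈98304 * (m : ℝ) / e ^ 2⌉₊ with hn
  have hme : 1 ≤ (m : ℝ) / e ^ 2 := by
    rw [le_div_iff₀ (by positivity)]
    have : e ^ 2 ≤ 1 := pow_le_one₀ he0.le he1
    linarith
  have hn1 : 98304 * (m : ℝ) / e ^ 2 ≤ n := Nat.le_ceil _
  have hn2 : (n : ℝ) ≤ 98305 * (m / e ^ 2) := by
    have := Nat.ceil_lt_add_one (show 0 ≤ 98304 * (m : ℝ) / e ^ 2 by positivity)
    rw [mul_div_assoc] at this
    rw [hn, mul_div_assoc]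
    linarith
  set R₁ : ℕ → ℕ := fun l => ⌈50 / (e * 2 ^ (l + 1))⌉₊ with hR₁
  set R₂ : ℕ → ℕ := fun l =>
    ⌈512 * ((I : ℝ) + 1) / (((1 / 2 : ℝ) ^ (l + 1)) ^ 2 * (e * 2 ^ (l + 1)))⌉₊ with hR₂
  have hR₁le : ∀ l < m, (R₁ l : ℝ) ≤ 51 / (e * 2 ^ (l + 1)) := fun l hl => by
    have h3 := Nat.ceil_lt_add_one (show 0 ≤ 50 / (e * 2 ^ (l + 1)) by positivity)
    have h4 : 1 ≤ 1 / (e * 2 ^ (l + 1)) := (one_le_div (by positivity)).2 (hγ1 l hl)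
    have h5 : 51 / (e * 2 ^ (l + 1)) = 50 / (e * 2 ^ (l + 1)) + 1 / (e * 2 ^ (l + 1)) := by ring
    rw [h5]
    exact h3.le.trans (by linarith)
  have hR₂le : ∀ l < m, (R₂ l : ℝ) ≤
      513 * (7 * m) / (((1 / 2 : ℝ) ^ (l + 1)) ^ 2 * (e * 2 ^ (l + 1))) := fun l hl => by
    set d : ℝ := ((1 / 2 : ℝ) ^ (l + 1)) ^ 2 * (e * 2 ^ (l + 1)) with hd
    have hd0 : 0 < d := by positivity
    have hd1 : d ≤ 1 := by
      have h2 : ((1 / 2 : ℝ) ^ (l + 1)) ^ 2 ≤ 1 :=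
        pow_le_one₀ (by positivity) (pow_le_one₀ (by norm_num) (by norm_num))
      exact mul_le_one₀ h2 (by positivity) (hγ1 l hl)
    have h3 := Nat.ceil_lt_add_one (show 0 ≤ 512 * ((I : ℝ) + 1) / d by positivity)
    have h4 : 1 ≤ ((I : ℝ) + 1) / d := (one_le_div hd0).2 (by linarith [Nat.cast_nonneg (α := ℝ) I])
    have h5 : 513 * ((I : ℝ) + 1) / d ≤ 513 * (7 * m) / d :=
      div_le_div_of_nonneg_right (by linarith) hd0.le
    have h6 : 513 * ((I : ℝ) + 1) / d = 512 * ((I : ℝ) + 1) / d + ((I : ℝ) + 1) / d := by ring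
    exact h3.le.trans (by linarith)
  have hRR : ∀ l < m, (R₁ l : ℝ) * R₂ l ≤ 183141 * (m / e ^ 2) := fun l hl => by
    refine (mul_le_mul (hR₁le l hl) (hR₂le l hl) (Nat.cast_nonneg _) (by positivity)).trans
      (le_of_eq ?_)
    rw [div_mul_div_comm]
    have : e * 2 ^ (l + 1) * (((1 / 2 : ℝ) ^ (l + 1)) ^ 2 * (e * 2 ^ (l + 1))) = e ^ 2 := by
      calc _ = ((1 / 2 : ℝ) ^ (l + 1) * (e * 2 ^ (l + 1))) ^ 2 := by ring
        _ = e ^ 2 := by rw [hδγ l]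
    rw [this]
    ring
  refine ⟨m, Nat.log 2 N + 2 * m + 6, T, I, n, e, R₁, R₂, he0, ?_, ?_, ?_, Nat.le_ceil _, ?_, ?_,
    ?_, ?_, ?_, ?_⟩
  · nlinarith [show (0 : ℝ) < (1 / 2) ^ m by positivity]
  · rw [he]
    field_simp
    exact le_rfl
  · -- `N < 2 ^ (log₂ N + 1)`, and the other factors of two beat `1 / e`
    have hN : (N : ℝ) < 2 ^ (Nat.log 2 N + 1) := by
      exact_mod_cast Nat.lt_pow_succ_log_self (by norm_num) N
    have hsplit : (1 / 2 : ℝ) ^ (Nat.log 2 N + 2 * m + 6) =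
        (1 / 2 : ℝ) ^ (Nat.log 2 N + 1) * (((1 / 2 : ℝ) ^ m) ^ 2 * (1 / 32)) := by
      rw [show Nat.log 2 N + 2 * m + 6 = Nat.log 2 N + 1 + (m * 2 + 5) by ring,
        pow_add _ (Nat.log 2 N + 1), pow_add _ (m * 2), pow_mul]
      norm_num
    have hprod : (2 : ℝ) ^ (Nat.log 2 N + 1) * (1 / 2 : ℝ) ^ (Nat.log 2 N + 1) = 1 := by
      rw [← mul_pow]; norm_num
    have hh : 0 < (1 / 2 : ℝ) ^ m := by positivity
    have h2 : N * (1 / 2 : ℝ) ^ (Nat.log 2 N + 1) < 1 := by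
      have := mul_lt_mul_of_pos_right hN
        (show (0 : ℝ) < (1 / 2) ^ (Nat.log 2 N + 1) by positivity)
      linarith
    have h3 : 4 * N * (1 / 2 : ℝ) ^ (Nat.log 2 N + 2 * m + 6) < ((1 / 2 : ℝ) ^ m) ^ 2 / 8 := by
      rw [hsplit]
      have := mul_lt_mul_of_pos_right h2 (show 0 < ((1 / 2 : ℝ) ^ m) ^ 2 / 8 by positivity)
      linarith
    refine h3.trans_le ?_
    rw [he, div_le_div_iff₀ (by norm_num) (by positivity)]
    have h5 : ((2 : ℝ) ^ m) ^ 2 * ((1 / 2 : ℝ) ^ m) ^ 2 = 1 := by rw [← mul_pow, hmhalf, one_pow]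
    have h6 := mul_le_mul_of_nonneg_right h4m (sq_nonneg ((1 / 2 : ℝ) ^ m))
    have h7 : ((2 : ℝ) ^ m) ^ 2 * ε * ((1 / 2 : ℝ) ^ m) ^ 2 = ε := by
      linear_combination ε * h5
    linarith
  · rw [he, hI, pow_add, mul_comm 2 m, pow_mul, mul_div_assoc', le_div_iff₀ (by positivity)]
    norm_num
    linarith
  · refine le_trans ?_ hn1
    rw [div_pow, div_div_eq_mul_div]
    refine div_le_div_of_nonneg_right ?_ (by positivity)
    linarith
  · intro l _
    have := Nat.le_ceil (50 / (e * 2 ^ (l + 1)))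
    rwa [div_le_iff₀ (by positivity)] at this
  · intro l _
    have := Nat.le_ceil
      (512 * ((I : ℝ) + 1) / (((1 / 2 : ℝ) ^ (l + 1)) ^ 2 * (e * 2 ^ (l + 1))))
    rwa [div_le_iff₀ (by positivity)] at this
  · refine le_trans ?_ (comparisons_mul_exp_le h0 hm5 hm he)
    have hs : ∑ l ∈ Finset.range m, 2 * ((R₁ l : ℝ) * R₂ l) ≤ 366282 * (m : ℝ) ^ 2 / e ^ 2 := by
      calc ∑ l ∈ Finset.range m, 2 * ((R₁ l : ℝ) * R₂ l)
          ≤ ∑ l ∈ Finset.range m, 366282 * ((m : ℝ) / e ^ 2) :=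
            Finset.sum_le_sum fun l hl => by linarith [hRR l (Finset.mem_range.1 hl)]
        _ = _ := by rw [Finset.sum_const, Finset.card_range, nsmul_eq_mul]; ring
    refine mul_le_mul hs ?_ (by positivity) (by positivity)
    refine mul_le_mul_of_nonneg_left (Real.exp_le_exp.2 (neg_le_neg ?_)) (by norm_num)
    rw [div_le_iff₀ (by positivity)] at hn1
    have : (n : ℝ) * (e / 32) ^ 2 / 8 = n * e ^ 2 / 8192 := by ring
    rw [this]
    linarith
  · have hterm : ∀ l ∈ Finset.range m, (R₁ l : ℝ) * (R₂ l * (2 * n) + T + 1) +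
        R₁ l * (R₂ l * (2 * n) + T + 1) ≤
        4 * (183141 * (m / e ^ 2)) * (98305 * (m / e ^ 2)) +
          2 * (51 / e) * (10 * Λ + 41 * m) := by
      intro l hl
      have hl := Finset.mem_range.1 hl
      have h2 : (R₁ l : ℝ) * R₂ l * n ≤ 183141 * (m / e ^ 2) * (98305 * (m / e ^ 2)) :=
        mul_le_mul (hRR l hl) hn2 (Nat.cast_nonneg _) (by positivity)
      have h3 : (R₁ l : ℝ) ≤ 51 / e :=
        (hR₁le l hl).trans (div_le_div_of_nonneg_left (by norm_num) he0 (hγe l))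
      have h4 : (R₁ l : ℝ) * (T + 1) ≤ 51 / e * (10 * Λ + 41 * m) :=
        mul_le_mul h3 hTle (by positivity) (by positivity)
      linarith
    have hsum := Finset.sum_le_sum hterm
    rw [Finset.sum_const, Finset.card_range, nsmul_eq_mul] at hsum
    push_cast
    refine hsum.trans ?_
    set y := 1 / ε with hy
    have hy1 : 1 ≤ y := (one_le_div h0).2 h1.le
    have hei : 1 / e = 80 * m * y := by rw [he, hy]; field_simp
    have e1 : (m : ℝ) / e ^ 2 = 6400 * m ^ 3 * y ^ 2 := by
      rw [div_eq_mul_one_div, ← one_div_pow, hei]; ring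
    have e2 : 51 / e = 4080 * m * y := by rw [div_eq_mul_one_div, hei]; ring
    have e3 : Λ / ε = Λ * y := by rw [hy]; ring
    have e4 : 1 / ε ^ 5 = y ^ 5 := by rw [hy, one_div_pow]
    have hy0 : 0 ≤ y := by linarith
    have hm1 : (1 : ℝ) ≤ m := by linarith
    rw [e1, e2, e3, e4]
    have p1 : (m : ℝ) ^ 7 * y ^ 4 ≤ m ^ 7 * y ^ 5 :=
      mul_le_mul_of_nonneg_left (pow_le_pow_right₀ hy1 (by norm_num)) (by positivity)
    have p2 : (m : ℝ) ^ 2 * (Λ * y) ≤ m ^ 7 * (Λ * y) :=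
      mul_le_mul_of_nonneg_right (pow_le_pow_right₀ hm1 (by norm_num)) (by positivity)
    have p3 : (m : ℝ) ^ 3 * y ≤ m ^ 7 * y ^ 5 :=
      mul_le_mul (pow_le_pow_right₀ hm1 (by norm_num)) (le_self_pow₀ hy1 (by norm_num)) hy0
        (by positivity)
    have p4 : (m : ℝ) ^ 7 ≤ 6 ^ 7 * (1 + Real.posLog y) ^ 7 := by
      rw [← mul_pow]
      exact pow_le_pow_left₀ hm0.le (le_six_mul_one_add_posLog h0 hm') 7
    have p5 : (m : ℝ) ^ 7 * (Λ * y + y ^ 5) ≤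
        6 ^ 7 * (1 + Real.posLog y) ^ 7 * (Λ * y + y ^ 5) :=
      mul_le_mul_of_nonneg_right p4 (by positivity)
    have p6 : 0 ≤ (m : ℝ) ^ 7 * (Λ * y) := by positivity
    have p7 : 0 ≤ (m : ℝ) ^ 7 * y ^ 5 := by positivity
    calc (m : ℝ) * (4 * (183141 * (6400 * m ^ 3 * y ^ 2)) * (98305 * (6400 * m ^ 3 * y ^ 2)) +
          2 * (4080 * m * y) * (10 * Λ + 41 * m))
        = 4 * 183141 * 98305 * 6400 ^ 2 * (m ^ 7 * y ^ 4) + 81600 * (m ^ 2 * (Λ * y)) +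
            334560 * (m ^ 3 * y) := by ring
      _ ≤ 4 * 10 ^ 18 * (m ^ 7 * (Λ * y + y ^ 5)) := by linarith
      _ ≤ 4 * 10 ^ 18 * (6 ^ 7 * (1 + Real.posLog y) ^ 7 * (Λ * y + y ^ 5)) :=
          mul_le_mul_of_nonneg_left p5 (by norm_num)
      _ = 4 * 10 ^ 18 * 6 ^ 7 * ((1 + Real.posLog y) ^ 7 * (Λ * y + y ^ 5)) := by ring
      _ ≤ 10 ^ 25 * ((1 + Real.posLog y) ^ 7 * (Λ * y + y ^ 5)) := by
          refine mul_le_mul_of_nonneg_right (by norm_num) ?_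
          have := Real.posLog_nonneg (x := y)
          positivity
      _ = _ := by ring

end Parameters

lemma dTV_le_one {Ω : Type} [Fintype Ω] (μ τ : PMF Ω) : dTV μ τ ≤ 1 := by
  have h : ∑ x, |(μ x).toReal - (τ x).toReal| ≤ ∑ x, ((μ x).toReal + (τ x).toReal) :=
    Finset.sum_le_sum fun x _ => abs_le.2 (by
      have h1 : 0 ≤ (μ x).toReal := ENNReal.toReal_nonneg
      have h2 : 0 ≤ (τ x).toReal := ENNReal.toReal_nonneg
      constructor <;> linarith)
  rw [Finset.sum_add_distrib, sum_toReal_eq_one, sum_toReal_eq_one] at h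
  rw [dTV]
  linarith

lemma two_thirds_le_of_toReal {β : Type} (p : PMF β) (b : β) (h : 2 / 3 ≤ (p b).toReal) :
    (2 / 3 : ℝ≥0∞) ≤ p b := by
  rw [← ENNReal.ofReal_toReal (PMF.apply_ne_top p b)]
  refine le_trans (le_of_eq ?_) (ENNReal.ofReal_le_ofReal h)
  rw [ENNReal.ofReal_div_of_pos (by norm_num)]
  norm_num

end CondSampling

theorem theorem1p3 :
    ∃ (C : ℝ) (k : ℕ), ∀ (N : ℕ) (ε : ℝ), 0 < ε →
      ∃ (q : ℕ) (alg : CondSampling.CondAlg (Fin 2) (Fin N) Bool),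
        (q : ℝ) ≤ C * (Real.posLog (Real.log N) / ε + 1 / ε ^ 5)
            * (1 + Real.posLog (1 / ε)) ^ k ∧
        alg.maxQueries ≤ q ∧
        ∀ (μ τ : PMF (Fin N)) (Oμ Oτ : Set (Fin N) → PMF (Fin N)),
          CondSampling.IsCondOracle μ Oμ → CondSampling.IsCondOracle τ Oτ →
          (μ = τ → (2 / 3 : ℝ≥0∞) ≤ alg.run ![Oμ, Oτ] true) ∧
          (ε < CondSampling.dTV μ τ → (2 / 3 : ℝ≥0∞) ≤ alg.run ![Oμ, Oτ] false) := by
  refine ⟨10 ^ 25, 7, fun N ε hε => ?_⟩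
  rcases le_or_gt 1 ε with h1 | h1
  · -- The distance never exceeds one, so that accepting without any query is correct.
    refine ⟨0, .output true, ?_, by simp [CondSampling.CondAlg.maxQueries], ?_⟩
    · have := Real.posLog_nonneg (x := Real.log N)
      have := Real.posLog_nonneg (x := 1 / ε)
      push_cast
      positivity
    · refine fun μ τ Oμ Oτ _ _ => ⟨fun _ => ?_, fun h => ?_⟩
      · exact CondSampling.two_thirds_le_of_toReal _ _
          (by simp [CondSampling.CondAlg.run, PMF.pure_apply]; norm_num)
      · linarith [CondSampling.dTV_le_one μ τ]
  · obtain ⟨m, J, T, I, n, e, R₁, R₂, he, hm, hem, hJ, hT, hI, hn, hR₁, hR₂, hcompl, hq⟩ :=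
      CondSampling.exists_parameters N hε h1
    refine ⟨_, CondSampling.tester (Fin N) m J T I n (e / 32) R₁ R₂, hq,
      CondSampling.maxQueries_tester _ _ _ _ _ _ _ _, fun μ τ Oμ Oτ hμ hτ => ⟨?_, ?_⟩⟩
    · rintro rfl
      have := CondSampling.le_acc_tester (O := ![Oμ, Oτ]) (μ := μ) hμ hτ m J T I n
        (t := e / 32) (by positivity) R₁ R₂
      exact CondSampling.two_thirds_le_of_toReal _ _ (by
        change 2 / 3 ≤ CondSampling.CondAlg.acc _ _
        linarith)
    · intro hdist
      have := CondSampling.acc_tester_le (O := ![Oμ, Oτ]) (μ := μ) (τ := τ) hμ hτ he hdist hm hem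
        (by simpa using hJ) hT hI hn hR₁ hR₂
      refine CondSampling.two_thirds_le_of_toReal _ _ ?_
      rw [CondSampling.CondAlg.run_false_toReal]
      linarith
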